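/- Let $n\ge 1$ be an integer and $c>0$. **Notation.** Let $\mathcal F(\mathbb R^n)$ be the set of convex lower semicontinuous functions $f:\mathbb R^n\to\mathbb R\cup\{+\infty\}$ that are not identically $+\infty$; let $\mathcal F_s(\mathbb R^n)$ be the set of symmetric $f\in\mathcal F(\mathbb R^n)$, i.e. $f(-x)=f(x)$, and $\mathcal F_u(\mathbb R^n)$ the set of unconditional ones, i.e. $f(\varepsilon_1x_1,\dots,\varepsilon_nx_n)=f(x_1,\dots,x_n)$ for all $\varepsilon\in\{-1,1\}^n$. Put $f^*(y)=\sup_{x}\{x\cdot y-f(x)\}$. One says that $\mathrm{IS}_n(c)$ holds if $$\int_{\mathbb R^n} e^{-f}\,dx\int_{\mathbb R^n} e^{-f^*}\,dx\ \ge\ c^n$$ for every $f\in\mathcal F(\mathbb R^n)$ with $\int e^{-f}\,dx>0$ and $\int e^{-f^*}\,dx>0$ (the integrals may be $+\infty$). The inequalities $\mathrm{IS}_{n,s}(c)$ and $\mathrm{IS}_{n,u}(c)$ are defined in the same way, with $\mathcal F_s(\mathbb R^n)$, respectively $\mathcal F_u(\mathbb R^n)$, in place of $\mathcal F(\mathbb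 R^n)$. Let $\mathcal P_1(\mathbb R^n)$ be the set of Borel probability measures on $\mathbb R^n$ with a finite first moment, and $\mathcal P_{s,1}(\mathbb R^n)$, respectively $\mathcal P_{u,1}(\mathbb R^n)$, the subset of those that are invariant under $x\mapsto -x$, respectively under all maps $x\mapsto(\varepsilon_1x_1,\dots,\varepsilon_nx_n)$ with $\varepsilon\in\{-1,1\}^n$. For $\nu_1,\nu_2,\eta\in\mathcal P_1(\mathbb R^n)$ put $$\mathcal T(\nu_1,\nu_2)=\inf_{f\in\mathcal F(\mathbb R^n)}\Big\{\int f\,d\nu_1+\int f^*\,d\nu_2\Big\}\in(-\infty,+\infty],$$ and $H(\eta\,|\,\mathrm{Leb})=\int h\log h\,dx\in(-\infty,+\infty]$ if $\eta$ has a density $h$ with respect to Lebesgue measure (with $0\log 0=0$), $H(\eta\,|\,\mathrm{Leb})=+\infty$ otherwise. **Statement.** 1. The following are equivalent: (a) $\mathrm{IS}_n(c)$ holds; (b) for all $\nu_1,\nu_2\in\mathcal P_1(\mathbb R^n)$, $$\inf_{\eta_1\in\mathcal P_1(\mathbb R^n)}\{\mathcal T(\nu_1,\eta_1)+H(\eta_1|\mathrm{Leb})\}+\inf_{\eta_2\in\mathcal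 P_1(\mathbb R^n)}\{\mathcal T(\nu_2,\eta_2)+H(\eta_2|\mathrm{Leb})\}\ \le\ -n\log c+\mathcal T(\nu_1,\nu_2),$$ where the infima take values in $[-\infty,+\infty)$; (c) the inequality in (b) holds for all compactly supported probability measures $\nu_1,\nu_2$ on $\mathbb R^n$ (with $\eta_1,\eta_2$ still ranging over $\mathcal P_1(\mathbb R^n)$). 2. The same equivalences hold with $\mathrm{IS}_{n,s}(c)$ in place of $\mathrm{IS}_n(c)$ when all of $\nu_1,\nu_2,\eta_1,\eta_2$ are required to belong to $\mathcal P_{s,1}(\mathbb R^n)$. 3. The same equivalences hold with $\mathrm{IS}_{n,u}(c)$ in place of $\mathrm{IS}_n(c)$ when all of $\nu_1,\nu_2,\eta_1,\eta_2$ are required to belong to $\mathcal P_{u,1}(\mathbb R^n)$. -/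

import Mathlib

open MeasureTheory

namespace InverseSantalo

/-- The Euclidean space `ℝⁿ`. -/
abbrev Rn (n : ℕ) : Type := EuclideanSpace ℝ (Fin n)

noncomputable section

/-- The integral `∫ f dμ ∈ [-∞, +∞]` of an extended real valued function, i.e. the difference
of the integrals of its positive and negative parts. Below it is only used where
the integral of the negative part is finite, so that the difference is never `∞ - ∞`. -/
def eintegral {α : Type} [MeasurableSpace α] (μ : Measure α) (f : α → EReal) : EReal :=
  ((∫⁻ x, (f x).toENNReal ∂μ : ENNReal) : EReal) - ((∫⁻ x, (-f x).toENNReal ∂μ : ENNReal) : EReal)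

/-! ### Convex functions and the Legendre transform -/

/-- The set `𝓕(ℝⁿ)` of lower semicontinuous convex functions `f : ℝⁿ → ℝ ∪ {+∞}` that are finite
at one point at least. -/
structure IsClosedConvex {n : ℕ} (f : Rn n → EReal) : Prop where
  ne_bot : ∀ x, f x ≠ ⊥
  exists_lt_top : ∃ x, f x < ⊤
  lsc : LowerSemicontinuous f
  convex : ∀ (x y : Rn n) (a b : ℝ), 0 < a → 0 < b → a + b = 1 →
    f (a • x + b • y) ≤ (a : EReal) * f x + (b : EReal) * f y

/-- The Fenchel-Legendre transform `f*(y) = sup_x {x · y - f(x)}`. -/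
def legendre {n : ℕ} (f : Rn n → EReal) (y : Rn n) : EReal :=
  ⨆ x : Rn n, ((inner ℝ x y : ℝ) : EReal) - f x

/-- The map `(x₁, …, xₙ) ↦ (ε₁ x₁, …, εₙ xₙ)`. -/
def flip {n : ℕ} (ε : Fin n → ℝ) (x : Rn n) : Rn n :=
  WithLp.toLp 2 fun i => ε i * x i

/-- `ε ∈ {-1, 1}ⁿ`. -/
def IsSignVector {n : ℕ} (ε : Fin n → ℝ) : Prop := ∀ i, ε i = 1 ∨ ε i = -1

/-- Symmetric functions. -/
def IsSymmFun {n : ℕ} (f : Rn n → EReal) : Prop := ∀ x, f (-x) = f x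

/-- Unconditional functions. -/
def IsUncondFun {n : ℕ} (f : Rn n → EReal) : Prop :=
  ∀ ε : Fin n → ℝ, IsSignVector ε → ∀ x, f (flip ε x) = f x

/-! ### The functional inverse Santaló inequalities -/

/-- `∫ e^{-f} dx`, as an element of `[0, +∞]`. -/
def expInt {n : ℕ} (f : Rn n → EReal) : ENNReal := ∫⁻ x, EReal.exp (-f x)

/-- The functional inverse Santaló inequality with constant `c` for the functions of `𝓕(ℝⁿ)` with
the property `P`. -/
def InverseSantaloOn (n : ℕ) (c : ℝ) (P : (Rn n → EReal) → Prop) : Prop :=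
  ∀ f : Rn n → EReal, IsClosedConvex f → P f → 0 < expInt f → 0 < expInt (legendre f) →
    ENNReal.ofReal c ^ n ≤ expInt f * expInt (legendre f)

/-- `IS_n(c)`. -/
def IS (n : ℕ) (c : ℝ) : Prop := InverseSantaloOn n c fun _ => True

/-- `IS_{n,s}(c)`. -/
def ISsymm (n : ℕ) (c : ℝ) : Prop := InverseSantaloOn n c IsSymmFun

/-- `IS_{n,u}(c)`. -/
def ISuncond (n : ℕ) (c : ℝ) : Prop := InverseSantaloOn n c IsUncondFun

/-! ### Probability measures -/

/-- `𝓟₁(ℝⁿ)`: the Borel probability measures with a finite first moment. -/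
def P1 (n : ℕ) : Set (Measure (Rn n)) :=
  {ν | IsProbabilityMeasure ν ∧ Integrable (fun x => ‖x‖) ν}

/-- `𝓟_{s,1}(ℝⁿ)`: the symmetric elements of `𝓟₁(ℝⁿ)`. -/
def P1symm (n : ℕ) : Set (Measure (Rn n)) :=
  {ν | ν ∈ P1 n ∧ ν.map (fun x => -x) = ν}

/-- `𝓟_{u,1}(ℝⁿ)`: the unconditional elements of `𝓟₁(ℝⁿ)`. -/
def P1uncond (n : ℕ) : Set (Measure (Rn n)) :=
  {ν | ν ∈ P1 n ∧ ∀ ε : Fin n → ℝ, IsSignVector ε → ν.map (flip ε) = ν}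

/-- The maximal correlation cost
`𝓣(ν₁, ν₂) = inf {∫ f dν₁ + ∫ f* dν₂ : f ∈ 𝓕(ℝⁿ)}` of `ν₁, ν₂ ∈ 𝓟₁(ℝⁿ)`. -/
def maxCorr {n : ℕ} (ν₁ ν₂ : Measure (Rn n)) : EReal :=
  ⨅ (f : Rn n → EReal) (_ : IsClosedConvex f), eintegral ν₁ f + eintegral ν₂ (legendre f)

open Classical in
/-- The relative entropy `H(η | Leb) = ∫ h log h dx` with `h = dη/dx` if `η ≪ Leb`, and `+∞`
otherwise, for `η ∈ 𝓟₁(ℝⁿ)`. The convention `0 log 0 = 0` is that of `EReal`. -/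
def entropyLeb {n : ℕ} (η : Measure (Rn n)) : EReal :=
  if η ≪ volume then
    eintegral volume fun x =>
      ((η.rnDeriv volume x : ENNReal) : EReal) * ENNReal.log (η.rnDeriv volume x)
  else ⊤

/-- `inf {𝓣(ν, η) + H(η | Leb) : η ∈ M}`. -/
def infTransportEntropy {n : ℕ} (M : Set (Measure (Rn n))) (ν : Measure (Rn n)) : EReal :=
  ⨅ (η : Measure (Rn n)) (_ : η ∈ M), maxCorr ν η + entropyLeb η

/-- The inequality
`inf_{η₁ ∈ M} {𝓣(ν₁, η₁) + H(η₁ | Leb)} + inf_{η₂ ∈ M} {𝓣(ν₂, η₂) + H(η₂ | Leb)}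
  ≤ - n log c + 𝓣(ν₁, ν₂)`. -/
def TransportEntropyIneq {n : ℕ} (c : ℝ) (M : Set (Measure (Rn n)))
    (ν₁ ν₂ : Measure (Rn n)) : Prop :=
  infTransportEntropy M ν₁ + infTransportEntropy M ν₂ ≤
    ((-(n * Real.log c) : ℝ) : EReal) + maxCorr ν₁ ν₂

end

end InverseSantalo

namespace InverseSantalo

open Set Filter Topology
open scoped ENNReal Pointwise

/-! By the Gibbs variational principle, -log ∫ e^{-g} is the infimum of ∫ g dη + H(η | Leb) over η.
Formally, therefore, inf_η {𝓣(ν, η) + H(η | Leb)} is the infimum over φ of ∫ φ dν - log ∫ e^{-φ*},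
and the transport-entropy inequality is the logarithm of the inverse Santaló inequality, tested
against measures.

From functions to measures: bound both infima with a single pair (g, g*), each time choosing for η
an almost optimal Gibbs measure. Their sum is at most ∫ g* dν₁ + ∫ g dν₂ - log(∫ e^{-g} ∫ e^{-g*}),
and the inverse Santaló inequality bounds the last term. An arbitrary competitor f in 𝓣(ν₁, ν₂) need
not be invariant, and e^{-f} or e^{-f*} may have integral zero; `exists_regularization` replaces it
by an admissible g at a cost of ε times the first moments.

From compactly supported measures to functions: given f, one needs ν for which f is almost optimal
in ∫ φ dν - log ∫ e^{-φ*}, i.e. the moment measure of f*. A discrete version suffices. Approximate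
f* from below by y ↦ max_{x ∈ X} (x · y - f x) with X finite. The integral Z(u) of exp(-max_{x ∈ X}
(x · y - u x)) is log-concave in u by Prékopa–Leindler, so log Z lies below its tangent at u = f;
the slope is a probability vector w on X (`exists_weights`), and ν = ∑ w(x) δ_x works
(`le_infTransportEntropy_of_weights`). The same construction for f* gives ν₂. Since 𝓣(ν₁, ν₂) ≤ ∫ f
dν₁ + ∫ f* dν₂, the integrals of f and f* cancel, and what remains is c^n ≤ ∫ e^{-f} ∫ e^{-f*} up to
an arbitrarily small error.

The three cases are one statement about a finite group of linear isometries: the trivial group, {-1,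
1} and {-1, 1}ⁿ. -/

/-! ### The Prékopa–Leindler inequality -/

/-- With k = max K and l = min L, the translates l + K and k + L both lie in 2C, one to the left and
one to the right of k + l, so they overlap in at most one point. -/
theorem volume_add_volume_le_of_isCompact {K L : Set ℝ} (hK : IsCompact K) (hL : IsCompact L)
    (hK0 : K.Nonempty) (hL0 : L.Nonempty) {C : Set ℝ} (hC : ∀ a ∈ K, ∀ b ∈ L, (a + b) / 2 ∈ C) :
    volume K + volume L ≤ 2 * volume C := by
  set k := sSup K
  set l := sInf L
  have hk : k ∈ K := hK.sSup_mem hK0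
  have hl : l ∈ L := hL.sInf_mem hL0
  have hC2 : volume ((2 : ℝ) • C) = 2 * volume C := by
    rw [Measure.addHaar_smul]; simp
  have hsub : (fun x => l + x) '' K ∪ (fun x => k + x) '' L ⊆ (2 : ℝ) • C := by
    rintro _ (⟨a, ha, rfl⟩ | ⟨b, hb, rfl⟩)
    · exact ⟨_, hC a ha l hl, by simp; ring⟩
    · exact ⟨_, hC k hk b hb, by simp; ring⟩
  have hinter : (fun x => l + x) '' K ∩ (fun x => k + x) '' L ⊆ {k + l} := by
    rintro _ ⟨⟨a, ha, rfl⟩, ⟨b, hb, hab⟩⟩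
    have h1 : a ≤ k := le_csSup hK.bddAbove ha
    have h2 : l ≤ b := csInf_le hL.bddBelow hb
    simp only [mem_singleton_iff] at hab ⊢
    linarith
  have hnull : volume ((fun x => l + x) '' K ∩ (fun x => k + x) '' L) = 0 :=
    measure_mono_null hinter (by simp)
  have hLm : MeasurableSet ((fun x => k + x) '' L) :=
    (hL.image (by fun_prop)).measurableSet
  have h := measure_union_add_inter (μ := volume) ((fun x => l + x) '' K) hLm
  rw [hnull, add_zero] at h
  simp only [image_add_left, measure_preimage_add] at h
  rw [← h, ← hC2]
  refine measure_mono ?_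
  simpa only [image_add_left] using hsub

theorem volume_add_volume_le {A B C : Set ℝ} (hA : MeasurableSet A) (hB : MeasurableSet B)
    (hA0 : A.Nonempty) (hB0 : B.Nonempty) (hC : ∀ a ∈ A, ∀ b ∈ B, (a + b) / 2 ∈ C) :
    volume A + volume B ≤ 2 * volume C := by
  have key : ∀ {A : Set ℝ}, MeasurableSet A → A.Nonempty → ∀ {t M : ℝ≥0∞}, t ≠ ∞ →
      (∀ K ⊆ A, IsCompact K → K.Nonempty → volume K + t ≤ M) → volume A + t ≤ M := by
    intro A hA ⟨a, ha⟩ t M ht h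
    have : volume A ≤ M - t := by
      refine le_of_forall_lt_imp_le_of_dense fun r hr => ?_
      obtain ⟨K, hKA, hK, hrK⟩ := hA.exists_lt_isCompact hr
      refine ENNReal.le_sub_of_add_le_right ht ?_
      -- Inner regularity may return the empty set; adding a point of `A` repairs this.
      refine le_trans ?_ (h (insert a K) (insert_subset ha hKA) (hK.insert a) ⟨a, by simp⟩)
      gcongr
      exact hrK.le.trans (measure_mono (subset_insert _ _))
    have htM : t ≤ M := by
      have := h {a} (by simpa) isCompact_singleton (singleton_nonempty a)
      simpa using this
    calc volume A + t ≤ M - t + t := by gcongr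
      _ = M := tsub_add_cancel_of_le htM
  have h1 : ∀ L ⊆ B, IsCompact L → L.Nonempty → volume A + volume L ≤ 2 * volume C := by
    intro L hLB hL hL0
    refine key hA hA0 hL.measure_lt_top.ne fun K hKA hK hK0 => ?_
    exact volume_add_volume_le_of_isCompact hK hL hK0 hL0
      fun a ha b hb => hC a (hKA ha) b (hLB hb)
  -- `key` needs a finite `t`; if `A` has infinite measure, a singleton in `B` already forces `C` to
  -- have infinite measure.
  by_cases hAt : volume A = ∞
  · obtain ⟨b, hb⟩ := hB0
    have := h1 {b} (by simpa) isCompact_singleton (singleton_nonempty b)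
    simp only [hAt, top_add, top_le_iff] at this
    simp [this]
  · rw [add_comm]
    refine key hB hB0 hAt fun L hLB hL hL0 => ?_
    rw [add_comm]
    exact h1 L hLB hL hL0

/-- Layer-cake formula plus the one-dimensional Brunn–Minkowski inequality for superlevel sets.
Suprema equal to 1 make the levels t < 1 of `f` and `g` simultaneously nonempty and the levels t ≥ 1
simultaneously empty. -/
theorem lintegral_add_lintegral_le_of_iSup_eq_one {f g h : ℝ → ℝ} (hf : Measurable f)
    (hg : Measurable g) (hh : Measurable h) (hf0 : 0 ≤ f) (hg0 : 0 ≤ g) (hh0 : 0 ≤ h)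
    (hf1 : ∀ x, f x ≤ 1) (hg1 : ∀ x, g x ≤ 1)
    (hf2 : ∀ s < 1, ∃ x, s < f x) (hg2 : ∀ s < 1, ∃ x, s < g x)
    (H : ∀ x y, f x * g y ≤ h ((x + y) / 2) ^ 2) :
    (∫⁻ x, ENNReal.ofReal (f x)) + (∫⁻ x, ENNReal.ofReal (g x)) ≤
      2 * ∫⁻ x, ENNReal.ofReal (h x) := by
  have hm : ∀ u : ℝ → ℝ, Measurable fun t : ℝ => volume {a | t < u a} := fun u =>
    Antitone.measurable fun s t hst => measure_mono fun a ha => lt_of_le_of_lt hst ha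
  rw [lintegral_eq_lintegral_meas_lt _ (ae_of_all _ hf0) hf.aemeasurable,
    lintegral_eq_lintegral_meas_lt _ (ae_of_all _ hg0) hg.aemeasurable,
    lintegral_eq_lintegral_meas_lt _ (ae_of_all _ hh0) hh.aemeasurable,
    ← lintegral_add_left (hm f), ← lintegral_const_mul _ (hm h)]
  refine setLIntegral_mono ((hm h).const_mul _) fun t ht => ?_
  rcases lt_or_ge t 1 with h1 | h1
  · refine volume_add_volume_le (hf measurableSet_Ioi) (hg measurableSet_Ioi) (hf2 t h1)
      (hg2 t h1) fun a ha b hb => ?_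
    have ht' : (0 : ℝ) < t := ht
    have ha' : t < f a := ha
    have hb' : t < g b := hb
    have := H a b
    by_contra hcon
    have hc : h ((a + b) / 2) ≤ t := not_lt.1 hcon
    have h0 := hh0 ((a + b) / 2)
    simp only [Pi.zero_apply] at h0
    nlinarith
  · have e1 : {a | t < f a} = ∅ := by
      ext a; simpa using (hf1 a).trans h1
    have e2 : {a | t < g a} = ∅ := by
      ext a; simpa using (hg1 a).trans h1
    simp [e1, e2]

theorem four_mul_le_sq_add_ennreal (a b : ℝ≥0∞) : 4 * (a * b) ≤ (a + b) ^ 2 := by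
  by_cases ha : a = ∞
  · simp [ha]
  by_cases hb : b = ∞
  · simp [hb]
  lift a to NNReal using ha
  lift b to NNReal using hb
  norm_cast
  rw [← NNReal.coe_le_coe]
  push_cast
  nlinarith [sq_nonneg ((a : ℝ) - b)]

/-- Dividing by the suprema A, B and by √(AB) reduces to the additive inequality, which is stronger
than the multiplicative one by AM-GM. -/
theorem lintegral_mul_lintegral_le_sq_of_bounded {f g h : ℝ → ℝ} (hf : Measurable f)
    (hg : Measurable g) (hh : Measurable h) (hf0 : 0 ≤ f) (hg0 : 0 ≤ g) (hh0 : 0 ≤ h)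
    (hf1 : BddAbove (range f)) (hg1 : BddAbove (range g))
    (H : ∀ x y, f x * g y ≤ h ((x + y) / 2) ^ 2) :
    (∫⁻ x, ENNReal.ofReal (f x)) * (∫⁻ x, ENNReal.ofReal (g x)) ≤
      (∫⁻ x, ENNReal.ofReal (h x)) ^ 2 := by
  set A := ⨆ x, f x
  set B := ⨆ x, g x
  have hfA : ∀ x, f x ≤ A := le_ciSup hf1
  have hgB : ∀ x, g x ≤ B := le_ciSup hg1
  rcases le_or_gt A 0 with hA | hA
  · have : ∀ x, ENNReal.ofReal (f x) = 0 := fun x => ENNReal.ofReal_of_nonpos ((hfA x).trans hA)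
    simp [this]
  rcases le_or_gt B 0 with hB | hB
  · have : ∀ x, ENNReal.ofReal (g x) = 0 := fun x => ENNReal.ofReal_of_nonpos ((hgB x).trans hB)
    simp [this]
  set c := Real.sqrt (A * B)
  have hc : 0 < c := Real.sqrt_pos.2 (mul_pos hA hB)
  have hc2 : c ^ 2 = A * B := Real.sq_sqrt (mul_pos hA hB).le
  have key := lintegral_add_lintegral_le_of_iSup_eq_one (f := fun x => f x / A)
    (g := fun x => g x / B) (h := fun x => h x / c) (hf.div_const _) (hg.div_const _)
    (hh.div_const _) (fun x => div_nonneg (hf0 x) hA.le) (fun x => div_nonneg (hg0 x) hB.le)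
    (fun x => div_nonneg (hh0 x) hc.le) (fun x => (div_le_one hA).2 (hfA x))
    (fun x => (div_le_one hB).2 (hgB x))
    (fun s hs => by
      obtain ⟨x, hx⟩ := exists_lt_of_lt_ciSup (f := f) (show s * A < A by nlinarith)
      exact ⟨x, (lt_div_iff₀ hA).2 hx⟩)
    (fun s hs => by
      obtain ⟨x, hx⟩ := exists_lt_of_lt_ciSup (f := g) (show s * B < B by nlinarith)
      exact ⟨x, (lt_div_iff₀ hB).2 hx⟩)
    (fun x y => by
      rw [div_mul_div_comm, div_pow, hc2]
      exact div_le_div_of_nonneg_right (H x y) (mul_pos hA hB).le)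
  have scale : ∀ {u : ℝ → ℝ} {a : ℝ}, Measurable u → 0 < a →
      ∫⁻ x, ENNReal.ofReal (u x) = ENNReal.ofReal a * ∫⁻ x, ENNReal.ofReal (u x / a) := by
    intro u a hu ha
    rw [← lintegral_const_mul _ (hu.div_const a).ennreal_ofReal]
    refine lintegral_congr fun x => ?_
    rw [← ENNReal.ofReal_mul ha.le, mul_div_cancel₀ _ ha.ne']
  rw [scale hf hA, scale hg hB, scale hh hc]
  set F := ∫⁻ x, ENNReal.ofReal (f x / A)
  set G := ∫⁻ x, ENNReal.ofReal (g x / B)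
  set I := ∫⁻ x, ENNReal.ofReal (h x / c)
  have hFG : F * G ≤ I ^ 2 := by
    have h1 : 4 * (F * G) ≤ 4 * I ^ 2 := by
      calc 4 * (F * G) ≤ (F + G) ^ 2 := four_mul_le_sq_add_ennreal _ _
        _ ≤ (2 * I) ^ 2 := by gcongr
        _ = 4 * I ^ 2 := by rw [mul_pow]; norm_num
    exact (ENNReal.mul_le_mul_iff_right (by norm_num) (by norm_num)).1 h1
  have hcc : ENNReal.ofReal c ^ 2 = ENNReal.ofReal A * ENNReal.ofReal B := by
    rw [← ENNReal.ofReal_pow hc.le, hc2, ENNReal.ofReal_mul hA.le]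
  calc ENNReal.ofReal A * F * (ENNReal.ofReal B * G)
      = ENNReal.ofReal A * ENNReal.ofReal B * (F * G) := by ring
    _ ≤ ENNReal.ofReal A * ENNReal.ofReal B * I ^ 2 := by gcongr
    _ = (ENNReal.ofReal c * I) ^ 2 := by rw [mul_pow, hcc]

/-- The Prékopa–Leindler inequality on `ℝ`, at midpoints. -/
theorem prekopaLeindler_real {f g h : ℝ → ℝ≥0∞} (hf : Measurable f) (hg : Measurable g)
    (hh : Measurable h) (H : ∀ x y, f x * g y ≤ h ((x + y) / 2) ^ 2) :
    (∫⁻ x, f x) * (∫⁻ x, g x) ≤ (∫⁻ x, h x) ^ 2 := by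
  -- Truncation at height `N` and monotone convergence remove the boundedness assumption.
  have trunc : ∀ {u : ℝ → ℝ≥0∞}, Measurable u →
      ∫⁻ x, u x = ⨆ N : ℕ, ∫⁻ x, ENNReal.ofReal (min (u x) N).toReal := by
    intro u hu
    have : ∀ N : ℕ, ∀ x, ENNReal.ofReal (min (u x) N).toReal = min (u x) N := fun N x =>
      ENNReal.ofReal_toReal (ne_top_of_le_ne_top (ENNReal.natCast_ne_top N) (min_le_right _ _))
    simp only [this]
    rw [← lintegral_iSup (fun N => hu.min measurable_const)
      (fun N M hNM x => min_le_min le_rfl (by exact_mod_cast hNM))]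
    refine lintegral_congr fun x => ?_
    refine le_antisymm (le_of_forall_lt fun a ha => ?_) (iSup_le fun N => min_le_left _ _)
    obtain ⟨N, hN⟩ := ENNReal.exists_nat_gt (ne_top_of_lt ha)
    exact lt_of_lt_of_le (lt_min ha hN) (le_iSup (fun N : ℕ => min (u x) (N : ℝ≥0∞)) N)
  have mono : ∀ u : ℝ → ℝ≥0∞, Monotone fun N : ℕ =>
      ∫⁻ x, ENNReal.ofReal (min (u x) N).toReal := fun u N M hNM => lintegral_mono fun x =>
    ENNReal.ofReal_le_ofReal (ENNReal.toReal_mono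
      (ne_top_of_le_ne_top (ENNReal.natCast_ne_top M) (min_le_right _ _))
      (min_le_min le_rfl (by exact_mod_cast hNM)))
  have hlt : ∀ (u : ℝ → ℝ≥0∞) (N : ℕ) x, min (u x) N ≠ ∞ := fun u N x =>
    ne_top_of_le_ne_top (ENNReal.natCast_ne_top N) (min_le_right _ _)
  have step : ∀ N : ℕ, (∫⁻ x, ENNReal.ofReal (min (f x) N).toReal) *
      (∫⁻ x, ENNReal.ofReal (min (g x) N).toReal) ≤
      (∫⁻ x, ENNReal.ofReal (min (h x) N).toReal) ^ 2 := by
    intro N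
    have bdd : ∀ u : ℝ → ℝ≥0∞, BddAbove (range fun x => (min (u x) (N : ℝ≥0∞)).toReal) := by
      intro u
      refine ⟨N, ?_⟩
      rintro _ ⟨x, rfl⟩
      simpa using ENNReal.toReal_mono (ENNReal.natCast_ne_top N) (min_le_right (u x) N)
    refine lintegral_mul_lintegral_le_sq_of_bounded
      (hf.min measurable_const).ennreal_toReal (hg.min measurable_const).ennreal_toReal
      (hh.min measurable_const).ennreal_toReal (fun _ => ENNReal.toReal_nonneg)
      (fun _ => ENNReal.toReal_nonneg) (fun _ => ENNReal.toReal_nonneg) (bdd f) (bdd g)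
      fun x y => ?_
    rw [← ENNReal.toReal_mul, ← ENNReal.toReal_pow]
    refine ENNReal.toReal_mono (ENNReal.pow_ne_top (hlt h N _)) ?_
    rcases le_total (h ((x + y) / 2)) (N : ℝ≥0∞) with h1 | h1
    · rw [min_eq_left h1]
      exact (mul_le_mul' (min_le_left _ _) (min_le_left _ _)).trans (H x y)
    · rw [min_eq_right h1, sq]
      exact mul_le_mul' (min_le_right _ _) (min_le_right _ _)
  rw [trunc hf, trunc hg, trunc hh, ENNReal.iSup_mul]
  refine iSup_le fun N => ?_
  rw [ENNReal.mul_iSup]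
  refine iSup_le fun M => ?_
  refine (mul_le_mul' (mono f (le_max_left N M)) (mono g (le_max_right N M))).trans ?_
  refine (step (max N M)).trans ?_
  gcongr
  exact le_iSup (fun N : ℕ => ∫⁻ x, ENNReal.ofReal (min (h x) N).toReal) (max N M)

/-- Induction on the dimension: the inductive hypothesis on the fibres over s, t and (s + t) / 2 is
exactly the hypothesis of the one-dimensional inequality for the marginals. -/
theorem prekopaLeindler_pi : ∀ (n : ℕ) {f g h : (Fin n → ℝ) → ℝ≥0∞}, Measurable f →
    Measurable g → Measurable h →
    (∀ x y, f x * g y ≤ h ((1 / 2 : ℝ) • (x + y)) ^ 2) →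
    (∫⁻ x, f x) * (∫⁻ x, g x) ≤ (∫⁻ x, h x) ^ 2
  | 0, f, g, h, hf, hg, hh, H => by
    have e : ∀ u : (Fin 0 → ℝ) → ℝ≥0∞, ∫⁻ x, u x = u 0 := by
      intro u
      rw [lintegral_unique, volume_pi, Measure.pi_of_empty]
      simp only [measure_univ, mul_one]
      exact congrArg u (Subsingleton.elim _ _)
    rw [e f, e g, e h]
    simpa using H 0 0
  | n + 1, f, g, h, hf, hg, hh, H => by
    let e := (MeasurableEquiv.piFinSuccAbove (fun _ : Fin (n + 1) => ℝ) 0).symm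
    have he : MeasurePreserving e := (volume_preserving_piFinSuccAbove (fun _ => ℝ) 0).symm
    have hint : ∀ {u : (Fin (n + 1) → ℝ) → ℝ≥0∞}, Measurable u →
        ∫⁻ x, u x = ∫⁻ s, ∫⁻ y, u (e (s, y)) := by
      intro u hu
      rw [← he.lintegral_comp hu]
      exact lintegral_prod _ (hu.comp e.measurable).aemeasurable
    have hlin : ∀ s t x y, e ((s + t) / 2, (1 / 2 : ℝ) • (x + y)) =
        (1 / 2 : ℝ) • (e (s, x) + e (t, y)) := by
      intro s t x y
      ext i
      refine Fin.cases ?_ (fun j => ?_) i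
      · simp [e, MeasurableEquiv.piFinSuccAbove]; ring
      · simp [e, MeasurableEquiv.piFinSuccAbove]; ring
    rw [hint hf, hint hg, hint hh]
    have hm : ∀ {u : (Fin (n + 1) → ℝ) → ℝ≥0∞}, Measurable u →
        Measurable fun p : ℝ × (Fin n → ℝ) => u (e p) := fun hu => hu.comp e.measurable
    refine prekopaLeindler_real (hm hf).lintegral_prod_right' (hm hg).lintegral_prod_right'
      (hm hh).lintegral_prod_right' fun s t => ?_
    refine prekopaLeindler_pi n ((hm hf).comp measurable_prodMk_left)
      ((hm hg).comp measurable_prodMk_left) ((hm hh).comp measurable_prodMk_left) fun x y => ?_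
    have := H (e (s, x)) (e (t, y))
    rwa [← hlin] at this

/-- The Prékopa–Leindler inequality on `ℝⁿ`, at midpoints. -/
theorem prekopaLeindler {n : ℕ} {f g h : Rn n → ℝ≥0∞} (hf : Measurable f) (hg : Measurable g)
    (hh : Measurable h) (H : ∀ x y, f x * g y ≤ h ((1 / 2 : ℝ) • (x + y)) ^ 2) :
    (∫⁻ x, f x) * (∫⁻ x, g x) ≤ (∫⁻ x, h x) ^ 2 := by
  have he := (EuclideanSpace.volume_preserving_symm_measurableEquiv_toLp (Fin n)).symm
  rw [← he.lintegral_comp hf, ← he.lintegral_comp hg, ← he.lintegral_comp hh]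
  refine prekopaLeindler_pi n (hf.comp he.measurable) (hg.comp he.measurable)
    (hh.comp he.measurable) fun x y => ?_
  exact H _ _

/-! ### A tangent bound from midpoint concavity -/

/-- This replaces differentiating a log-concave function. Iteration gives z 0 ≤ (z k)^(2^k), while
the first-order bound gives z k ≤ exp(2^{-k} S + 4^{-k} D²); the error 2^{-k} D² left after raising
to the power 2^k vanishes in the limit. -/
theorem le_exp_sum_of_le_sq {ι : Type*} (X : Finset ι) (w d : ι → ℝ) (hw : ∀ x ∈ X, 0 ≤ w x)
    (hw1 : ∑ x ∈ X, w x = 1) (z : ℕ → ℝ) (hz0 : ∀ k, 0 ≤ z k) (hz : ∀ k, z k ≤ z (k + 1) ^ 2)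
    (hzw : ∀ k, z k ≤ ∑ x ∈ X, w x * Real.exp ((1 / 2) ^ k * d x)) :
    z 0 ≤ Real.exp (∑ x ∈ X, w x * d x) := by
  set S := ∑ x ∈ X, w x * d x
  set D := ∑ x ∈ X, |d x|
  have hD0 : 0 ≤ D := Finset.sum_nonneg fun _ _ => abs_nonneg _
  have hD : ∀ x ∈ X, |d x| ≤ D := fun x hx =>
    Finset.single_le_sum (f := fun x => |d x|) (fun _ _ => abs_nonneg _) hx
  have h1 : ∀ k, z 0 ≤ z k ^ (2 ^ k) := by
    intro k
    induction k with
    | zero => simp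
    | succ k ih =>
      refine ih.trans ?_
      rw [pow_succ, mul_comm, pow_mul]
      exact pow_le_pow_left₀ (hz0 k) (hz k) _
  have ht : Tendsto (fun k : ℕ => (1 / 2 : ℝ) ^ k) atTop (𝓝 0) :=
    tendsto_pow_atTop_nhds_zero_of_lt_one (by norm_num) (by norm_num)
  have hsmall : ∀ᶠ k : ℕ in atTop, (1 / 2 : ℝ) ^ k * D < 1 := by
    have : Tendsto (fun k : ℕ => (1 / 2 : ℝ) ^ k * D) atTop (𝓝 (0 * D)) := ht.mul_const D
    rw [zero_mul] at this
    exact this.eventually (gt_mem_nhds one_pos)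
  have h2 : ∀ᶠ k : ℕ in atTop, z 0 ≤ Real.exp (S + (1 / 2) ^ k * D ^ 2) := by
    filter_upwards [hsmall] with k hk
    set e : ℝ := (1 / 2) ^ k
    have he : 0 < e := by positivity
    have h3 : z k ≤ Real.exp (e * S + e ^ 2 * D ^ 2) := by
      calc z k ≤ ∑ x ∈ X, w x * Real.exp (e * d x) := hzw k
        _ ≤ ∑ x ∈ X, w x * (1 + e * d x + e ^ 2 * D ^ 2) := by
          refine Finset.sum_le_sum fun x hx => mul_le_mul_of_nonneg_left ?_ (hw x hx)
          have h4 : |e * d x| ≤ 1 := by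
            rw [abs_mul, abs_of_pos he]
            exact (mul_le_mul_of_nonneg_left (hD x hx) he.le).trans hk.le
          have h5 := (abs_le.1 (Real.abs_exp_sub_one_sub_id_le h4)).2
          have h6 : (e * d x) ^ 2 ≤ e ^ 2 * D ^ 2 := by
            rw [mul_pow]
            refine mul_le_mul_of_nonneg_left ?_ (by positivity)
            rw [← sq_abs (d x)]
            exact pow_le_pow_left₀ (abs_nonneg _) (hD x hx) 2
          linarith
        _ = 1 + e * S + e ^ 2 * D ^ 2 := by
          simp only [mul_add, Finset.sum_add_distrib, mul_one, ← Finset.sum_mul, hw1, one_mul, S,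
            Finset.mul_sum, mul_left_comm]
        _ ≤ Real.exp (e * S + e ^ 2 * D ^ 2) := by
          have := Real.add_one_le_exp (e * S + e ^ 2 * D ^ 2)
          linarith
    have he1 : e * 2 ^ k = 1 := by
      simp [e]
    calc z 0 ≤ z k ^ (2 ^ k) := h1 k
      _ ≤ Real.exp (e * S + e ^ 2 * D ^ 2) ^ (2 ^ k) := pow_le_pow_left₀ (hz0 k) h3 _
      _ = Real.exp (S + e * D ^ 2) := by
        rw [← Real.exp_nat_mul]
        congr 1
        push_cast
        linear_combination (S + e * D ^ 2) * he1
  have h3 : Tendsto (fun k : ℕ => Real.exp (S + (1 / 2) ^ k * D ^ 2)) atTop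
      (𝓝 (Real.exp (S + 0 * D ^ 2))) :=
    (Real.continuous_exp.tendsto _).comp ((ht.mul_const _).const_add _)
  rw [zero_mul, add_zero] at h3
  exact ge_of_tendsto h3 h2

/-! ### Integrals of maxima of affine functions and their tangents -/

section MaxAffine

variable {n : ℕ} {X : Finset (Rn n)} (hX : X.Nonempty)

/-- The function `y ↦ max_{x ∈ X} (x · y - u x)`. -/
noncomputable def maxAffine (u : Rn n → ℝ) (y : Rn n) : ℝ :=
  X.sup' hX fun x => inner ℝ x y - u x

/-- The integral of `exp (-max_{x ∈ X} (x · y - u x))`. -/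
noncomputable def maxAffineInt (u : Rn n → ℝ) : ℝ≥0∞ :=
  ∫⁻ y, ENNReal.ofReal (Real.exp (-maxAffine hX u y))

open Classical in
/-- The points of `X` at which the maximum in `maxAffine` is attained. -/
noncomputable def maxAffineArgmax (u : Rn n → ℝ) (y : Rn n) : Finset (Rn n) :=
  X.filter fun x => inner ℝ x y - u x = maxAffine hX u y

open Classical in
/-- The mass of the part of `exp (-maxAffine)` on which `x` attains the maximum, ties being split
equally. -/
noncomputable def maxAffineMass (u : Rn n → ℝ) (x : Rn n) : ℝ≥0∞ :=
  ∫⁻ y, (if x ∈ maxAffineArgmax hX u y then ((maxAffineArgmax hX u y).card : ℝ≥0∞)⁻¹ else 0) *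
    ENNReal.ofReal (Real.exp (-maxAffine hX u y))

theorem le_maxAffine (u : Rn n → ℝ) {x : Rn n} (hx : x ∈ X) (y : Rn n) :
    inner ℝ x y - u x ≤ maxAffine hX u y :=
  Finset.le_sup' (fun x => inner ℝ x y - u x) hx

theorem maxAffine_le (u : Rn n → ℝ) {y : Rn n} {a : ℝ} (h : ∀ x ∈ X, inner ℝ x y - u x ≤ a) :
    maxAffine hX u y ≤ a :=
  Finset.sup'_le hX _ h

theorem continuous_maxAffine (u : Rn n → ℝ) : Continuous (maxAffine hX u) :=
  Continuous.finset_sup'_apply hX fun x _ => by fun_prop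

theorem measurable_exp_neg_maxAffine (u : Rn n → ℝ) :
    Measurable fun y => ENNReal.ofReal (Real.exp (-maxAffine hX u y)) :=
  (Real.continuous_exp.comp (continuous_maxAffine hX u).neg).measurable.ennreal_ofReal

theorem maxAffineArgmax_nonempty (u : Rn n → ℝ) (y : Rn n) :
    (maxAffineArgmax hX u y).Nonempty := by
  obtain ⟨x, hx, h⟩ := Finset.exists_mem_eq_sup' hX fun x => inner ℝ x y - u x
  exact ⟨x, Finset.mem_filter.2 ⟨hx, h.symm⟩⟩

theorem measurableSet_mem_argmax (u : Rn n → ℝ) (x : Rn n) :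
    MeasurableSet {y | x ∈ maxAffineArgmax hX u y} := by
  by_cases hx : x ∈ X
  · simp only [maxAffineArgmax, Finset.mem_filter, hx, true_and]
    exact (isClosed_eq (by fun_prop) (continuous_maxAffine hX u)).measurableSet
  · simp [maxAffineArgmax, hx]

theorem measurable_argmax_card (u : Rn n → ℝ) :
    Measurable fun y => ((maxAffineArgmax hX u y).card : ℝ≥0∞) := by
  classical
  have : ∀ y, ((maxAffineArgmax hX u y).card : ℝ≥0∞) =
      ∑ x ∈ X, {y | x ∈ maxAffineArgmax hX u y}.indicator 1 y := by
    intro y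
    have h : maxAffineArgmax hX u y = X.filter fun x => x ∈ maxAffineArgmax hX u y := by
      ext x; simp [maxAffineArgmax]
    rw [h, Finset.card_filter]
    push_cast
    refine Finset.sum_congr rfl fun x _ => ?_
    simp only [indicator_apply, mem_ofPred_eq, Pi.one_apply]
  simp only [this]
  exact Finset.measurable_sum _ fun x _ =>
    measurable_one.indicator (measurableSet_mem_argmax hX u x)

open Classical in
theorem measurable_maxAffineMass_integrand (u : Rn n → ℝ) (x : Rn n) :
    Measurable fun y => (if x ∈ maxAffineArgmax hX u y then
      ((maxAffineArgmax hX u y).card : ℝ≥0∞)⁻¹ else 0) *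
        ENNReal.ofReal (Real.exp (-maxAffine hX u y)) :=
  (Measurable.ite (measurableSet_mem_argmax hX u x) (measurable_argmax_card hX u).inv
    measurable_const).mul (measurable_exp_neg_maxAffine hX u)

open Classical in
theorem sum_argmax_inv_card (u : Rn n → ℝ) (y : Rn n) :
    ∑ x ∈ X, (if x ∈ maxAffineArgmax hX u y then
      ((maxAffineArgmax hX u y).card : ℝ≥0∞)⁻¹ else 0) = 1 := by
  have hsub : X.filter (fun x => x ∈ maxAffineArgmax hX u y) = maxAffineArgmax hX u y := by
    ext x; simp [maxAffineArgmax]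
  rw [← Finset.sum_filter, hsub, Finset.sum_const, nsmul_eq_mul]
  refine ENNReal.mul_inv_cancel ?_ (ENNReal.natCast_ne_top _)
  exact_mod_cast (Finset.card_pos.2 (maxAffineArgmax_nonempty hX u y)).ne'

theorem sum_maxAffineMass (u : Rn n → ℝ) :
    ∑ x ∈ X, maxAffineMass hX u x = maxAffineInt hX u := by
  classical
  unfold maxAffineMass maxAffineInt
  rw [← lintegral_finsetSum _ fun x _ => measurable_maxAffineMass_integrand hX u x]
  refine lintegral_congr fun y => ?_
  rw [← Finset.sum_mul, sum_argmax_inv_card, one_mul]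

/-- Any x attaining the maximum for `u` at y bounds the maximum for u + d from below by the old
maximum minus d(x). Averaging over the maximizers makes it unnecessary to know that ties form a null
set. -/
theorem maxAffineInt_add_le (u d : Rn n → ℝ) :
    maxAffineInt hX (fun x => u x + d x) ≤
      ∑ x ∈ X, maxAffineMass hX u x * ENNReal.ofReal (Real.exp (d x)) := by
  classical
  unfold maxAffineMass
  simp only [← lintegral_mul_const _ (measurable_maxAffineMass_integrand hX u _)]
  rw [← lintegral_finsetSum _ fun x _ =>
    (measurable_maxAffineMass_integrand hX u x).mul_const _]
  refine lintegral_mono fun y => ?_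
  rw [← one_mul (ENNReal.ofReal _), ← sum_argmax_inv_card hX u y, Finset.sum_mul]
  refine Finset.sum_le_sum fun x hx => ?_
  by_cases hxa : x ∈ maxAffineArgmax hX u y
  · rw [mul_assoc]
    gcongr
    rw [← ENNReal.ofReal_mul (Real.exp_pos _).le, ← Real.exp_add]
    refine ENNReal.ofReal_le_ofReal (Real.exp_le_exp.2 ?_)
    have h1 := le_maxAffine hX (fun x => u x + d x) hx y
    have h2 := (Finset.mem_filter.1 hxa).2
    linarith
  · simp [hxa]

/-- The maximum of x · y - u x is jointly convex in (u, y), so Prékopa–Leindler applies. -/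
theorem maxAffineInt_mul_le (u v : Rn n → ℝ) :
    maxAffineInt hX u * maxAffineInt hX v ≤
      maxAffineInt hX (fun x => (u x + v x) / 2) ^ 2 := by
  refine prekopaLeindler (measurable_exp_neg_maxAffine hX u) (measurable_exp_neg_maxAffine hX v)
    (measurable_exp_neg_maxAffine hX _) fun y z => ?_
  rw [← ENNReal.ofReal_mul (Real.exp_pos _).le, ← ENNReal.ofReal_pow (Real.exp_pos _).le,
    ← Real.exp_add, ← Real.exp_nat_mul]
  refine ENNReal.ofReal_le_ofReal (Real.exp_le_exp.2 ?_)
  have : maxAffine hX (fun x => (u x + v x) / 2) ((1 / 2 : ℝ) • (y + z)) ≤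
      (maxAffine hX u y + maxAffine hX v z) / 2 := by
    refine maxAffine_le hX _ fun x hx => ?_
    have h1 := le_maxAffine hX u hx y
    have h2 := le_maxAffine hX v hx z
    rw [inner_smul_right, inner_add_right]
    linarith
  push_cast
  linarith

theorem maxAffineInt_ne_zero (u : Rn n → ℝ) : maxAffineInt hX u ≠ 0 := by
  unfold maxAffineInt
  rw [ne_eq, lintegral_eq_zero_iff (measurable_exp_neg_maxAffine hX u)]
  intro h
  have h2 : (∀ᵐ y : Rn n, False) := by
    filter_upwards [h] with y hy
    simp only [Pi.zero_apply, ENNReal.ofReal_eq_zero] at hy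
    exact absurd hy (not_le.2 (Real.exp_pos _))
  simp only [ae_iff, not_false_eq_true, ofPred_true] at h2
  exact NeZero.ne (volume : Measure (Rn n)) (Measure.measure_univ_eq_zero.1 h2)

/-- An isometry preserving the data carries maximizers at y to maximizers at e y; the equal
splitting of ties respects this symmetry. -/
theorem maxAffineMass_map (u : Rn n → ℝ) (e : Rn n ≃ₗᵢ[ℝ] Rn n) (hXe : ∀ x, e x ∈ X ↔ x ∈ X)
    (hu : ∀ x ∈ X, u (e x) = u x) (x : Rn n) :
    maxAffineMass hX u (e x) = maxAffineMass hX u x := by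
  classical
  have hmax : ∀ y, maxAffine hX u (e y) = maxAffine hX u y := by
    intro y
    refine le_antisymm (maxAffine_le hX u fun x hx => ?_) (maxAffine_le hX u fun x hx => ?_)
    · obtain ⟨x, rfl⟩ := e.surjective x
      rw [hXe] at hx
      rw [e.inner_map_map, hu x hx]
      exact le_maxAffine hX u hx y
    · rw [← e.inner_map_map, ← hu x hx]
      exact le_maxAffine hX u ((hXe x).2 hx) _
  have hmem : ∀ x y, e x ∈ maxAffineArgmax hX u (e y) ↔ x ∈ maxAffineArgmax hX u y := by
    intro x y
    simp only [maxAffineArgmax, Finset.mem_filter, hXe, hmax, e.inner_map_map]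
    exact and_congr_right fun hx => by rw [hu x hx]
  have hcard : ∀ y, (maxAffineArgmax hX u (e y)).card = (maxAffineArgmax hX u y).card := by
    intro y
    refine (Finset.card_bij (fun x _ => e x) (fun x hx => (hmem x y).2 hx)
      (fun _ _ _ _ h => e.injective h) fun x hx => ?_).symm
    obtain ⟨x, rfl⟩ := e.surjective x
    exact ⟨x, (hmem x y).1 hx, rfl⟩
  unfold maxAffineMass
  rw [← e.measurePreserving.lintegral_comp (measurable_maxAffineMass_integrand hX u (e x))]
  simp only [hmem, hcard, hmax]

/-- The function `u ↦ -log ∫ exp (-max_{x ∈ X} (x · y - u x)) dy` lies above its tangent at `u`. The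
slope of the tangent is, up to the sign, the moment measure of `maxAffine hX u`. -/
theorem exists_weights (u : Rn n → ℝ) (hu : maxAffineInt hX u ≠ ∞) :
    ∃ w : Rn n → ℝ, (∀ x, 0 ≤ w x) ∧ ∑ x ∈ X, w x = 1 ∧
      (∀ v : Rn n → ℝ, maxAffineInt hX v ≤
        maxAffineInt hX u * ENNReal.ofReal (Real.exp (∑ x ∈ X, w x * (v x - u x)))) ∧
      ∀ e : Rn n ≃ₗᵢ[ℝ] Rn n, (∀ x, e x ∈ X ↔ x ∈ X) → (∀ x ∈ X, u (e x) = u x) →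
        ∀ x, w (e x) = w x := by
  set Z := maxAffineInt hX u
  have hZ0 : Z ≠ 0 := maxAffineInt_ne_zero hX u
  have hsum := sum_maxAffineMass hX u
  have hmass : ∀ x ∈ X, maxAffineMass hX u x ≠ ∞ := fun x hx =>
    ne_top_of_le_ne_top hu 
      ((Finset.single_le_sum (f := maxAffineMass hX u) (fun _ _ => zero_le) hx).trans hsum.le)
  refine ⟨fun x => (maxAffineMass hX u x / Z).toReal, fun x => ENNReal.toReal_nonneg, ?_, ?_, ?_⟩
  · rw [← ENNReal.toReal_sum fun x hx => ENNReal.div_ne_top (hmass x hx) hZ0]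
    simp only [div_eq_mul_inv, ← Finset.sum_mul, hsum]
    rw [ENNReal.mul_inv_cancel hZ0 hu, ENNReal.toReal_one]
  · intro v
    set d : Rn n → ℝ := fun x => v x - u x
    -- The perturbation u + 2^{-k} d starts at `v` for k = 0, and each one is the midpoint of `u`
    -- and its predecessor.
    set zk : ℕ → ℝ≥0∞ := fun k => maxAffineInt hX fun x => u x + (1 / 2) ^ k * d x
    have hzk : ∀ k, zk k ≤
        ∑ x ∈ X, maxAffineMass hX u x * ENNReal.ofReal (Real.exp ((1 / 2) ^ k * d x)) :=
      fun k => maxAffineInt_add_le hX u _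
    have hzt : ∀ k, zk k ≠ ∞ := fun k => ne_top_of_le_ne_top
      (ENNReal.sum_ne_top.2 fun x hx => ENNReal.mul_ne_top (hmass x hx) ENNReal.ofReal_ne_top)
      (hzk k)
    have hstep : ∀ k, Z * zk k ≤ zk (k + 1) ^ 2 := by
      intro k
      refine (maxAffineInt_mul_le hX u _).trans (le_of_eq ?_)
      congr 2
      ext x
      rw [pow_succ]
      ring
    have hmain : (zk 0 / Z).toReal ≤
        Real.exp (∑ x ∈ X, (maxAffineMass hX u x / Z).toReal * d x) := by
      refine le_exp_sum_of_le_sq X _ d (fun _ _ => ENNReal.toReal_nonneg) ?_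
        (fun k => (zk k / Z).toReal) (fun _ => ENNReal.toReal_nonneg) (fun k => ?_) fun k => ?_
      · rw [← ENNReal.toReal_sum fun x hx => ENNReal.div_ne_top (hmass x hx) hZ0]
        simp only [div_eq_mul_inv, ← Finset.sum_mul, hsum]
        rw [ENNReal.mul_inv_cancel hZ0 hu, ENNReal.toReal_one]
      · rw [← ENNReal.toReal_pow]
        refine ENNReal.toReal_mono (ENNReal.pow_ne_top (ENNReal.div_ne_top (hzt _) hZ0)) ?_
        calc zk k / Z = Z * zk k / (Z * Z) := by
              rw [ENNReal.mul_div_mul_left _ _ hZ0 hu]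
          _ ≤ zk (k + 1) ^ 2 / (Z * Z) := by gcongr; exact hstep k
          _ = (zk (k + 1) / Z) ^ 2 := by
            rw [div_eq_mul_inv, div_eq_mul_inv, mul_pow,
              ENNReal.mul_inv (Or.inl hZ0) (Or.inl hu), sq Z⁻¹]
      · have h1 : zk k / Z ≤ ∑ x ∈ X,
            maxAffineMass hX u x / Z * ENNReal.ofReal (Real.exp ((1 / 2) ^ k * d x)) := by
          calc zk k / Z ≤ (∑ x ∈ X, maxAffineMass hX u x *
                ENNReal.ofReal (Real.exp ((1 / 2) ^ k * d x))) / Z := by gcongr; exact hzk k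
            _ = _ := by
              simp only [div_eq_mul_inv, Finset.sum_mul]
              exact Finset.sum_congr rfl fun _ _ => by ring
        have hft : ∀ x ∈ X, maxAffineMass hX u x / Z *
            ENNReal.ofReal (Real.exp ((1 / 2) ^ k * d x)) ≠ ∞ := fun x hx =>
          ENNReal.mul_ne_top (ENNReal.div_ne_top (hmass x hx) hZ0) ENNReal.ofReal_ne_top
        refine (ENNReal.toReal_mono (ENNReal.sum_ne_top.2 hft) h1).trans (le_of_eq ?_)
        rw [ENNReal.toReal_sum hft]
        refine Finset.sum_congr rfl fun x _ => ?_
        rw [ENNReal.toReal_mul, ENNReal.toReal_ofReal (Real.exp_pos _).le]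
    have hv : maxAffineInt hX v = zk 0 := by
      simp [zk, d]
    rw [hv, mul_comm, ← ENNReal.div_le_iff hZ0 hu]
    exact (ENNReal.le_ofReal_iff_toReal_le (ENNReal.div_ne_top (hzt 0) hZ0)
      (Real.exp_pos _).le).2 hmain
  · intro e hXe hue x
    simp only [maxAffineMass_map hX u e hXe hue x]

end MaxAffine

/-! ### Legendre duality for extended real valued functions -/

section Legendre

variable {n : ℕ} {f : Rn n → EReal}

theorem inner_sub_le_legendre (f : Rn n → EReal) (x y : Rn n) :
    ((inner ℝ x y : ℝ) : EReal) - f x ≤ legendre f y :=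
  le_iSup (fun x => ((inner ℝ x y : ℝ) : EReal) - f x) x

/-- The Fenchel–Young inequality. -/
theorem inner_le_add_of_legendre_le {x y : Rn n} {r s : ℝ} (hr : f x ≤ r)
    (hs : legendre f y ≤ s) : inner ℝ x y ≤ r + s := by
  have h : ((inner ℝ x y : ℝ) : EReal) - (r : EReal) ≤ s :=
    (EReal.sub_le_sub le_rfl hr).trans ((inner_sub_le_legendre f x y).trans hs)
  have : inner ℝ x y - r ≤ s := by exact_mod_cast h
  linarith

/-- Testing real numbers r ≥ f x treats all values of f x at once: there is no such r for ⊤, and r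
is arbitrarily low for ⊥. -/
theorem legendre_le_of_forall {y : Rn n} {s : ℝ}
    (h : ∀ x, ∀ r : ℝ, f x ≤ r → inner ℝ x y - r ≤ s) : legendre f y ≤ s := by
  refine iSup_le fun x => ?_
  induction hx : f x with
  | bot =>
    have := h x (inner ℝ x y - s - 1) (by simp [hx])
    linarith
  | top => simp
  | coe r => exact_mod_cast h x r hx.le

theorem legendre_le_iff {y : Rn n} {s : ℝ} :
    legendre f y ≤ s ↔ ∀ x, ((inner ℝ x y - s : ℝ) : EReal) ≤ f x := by
  constructor
  · intro h x
    induction hx : f x with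
    | bot =>
      have := inner_le_add_of_legendre_le (f := f) (x := x) (r := inner ℝ x y - s - 1) (by simp [hx]) h
      linarith
    | top => simp
    | coe r =>
      have := inner_le_add_of_legendre_le hx.le h
      exact_mod_cast (by linarith : inner ℝ x y - s ≤ r)
  · intro h
    refine legendre_le_of_forall fun x r hr => ?_
    have : inner ℝ x y - s ≤ r := by exact_mod_cast (h x).trans hr
    linarith

theorem legendre_legendre_le (f : Rn n → EReal) (x : Rn n) : legendre (legendre f) x ≤ f x := by
  induction hx : f x with
  | bot =>
    refine iSup_le fun y => ?_
    have : legendre f y = ⊤ := by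
      have := inner_sub_le_legendre f x y
      simpa [hx] using this
    simp [this]
  | top => simp
  | coe r =>
    refine legendre_le_of_forall fun y s hs => ?_
    have := inner_le_add_of_legendre_le hx.le hs
    rw [real_inner_comm]
    linarith

theorem legendre_ne_bot (h : ∃ x, f x < ⊤) (y : Rn n) : legendre f y ≠ ⊥ := by
  obtain ⟨x, hx⟩ := h
  intro hy
  have := inner_sub_le_legendre f x y
  rw [hy, le_bot_iff] at this
  induction hfx : f x with
  | bot => simp [hfx] at this
  | top => simp [hfx] at hx
  | coe r =>
    rw [hfx, ← EReal.coe_sub] at this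
    exact EReal.coe_ne_bot _ this

theorem isClosedConvex_legendre (h1 : ∃ x, f x < ⊤) (h2 : ∃ y, legendre f y < ⊤) :
    IsClosedConvex (legendre f) where
  ne_bot := legendre_ne_bot h1
  exists_lt_top := h2
  lsc := by
    refine lowerSemicontinuous_iSup fun x => Continuous.lowerSemicontinuous ?_
    induction f x with
    | bot => simpa using continuous_const
    | top => simpa using continuous_const
    | coe r =>
      simp only [← EReal.coe_sub]
      exact continuous_coe_real_ereal.comp (by fun_prop)
  convex := by
    intro x y a b ha hb hab
    by_cases hx : legendre f x = ⊤
    · rw [hx, EReal.coe_mul_top_of_pos ha, EReal.top_add_of_ne_bot]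
      · exact le_top
      · have := legendre_ne_bot h1 y
        induction h : legendre f y with
        | bot => exact absurd h this
        | top => simp [EReal.coe_mul_top_of_pos hb]
        | coe r => rw [← EReal.coe_mul]; exact EReal.coe_ne_bot _
    by_cases hy : legendre f y = ⊤
    · rw [hy, EReal.coe_mul_top_of_pos hb, EReal.add_top_of_ne_bot]
      · exact le_top
      · have := legendre_ne_bot h1 x
        induction h : legendre f x with
        | bot => exact absurd h this
        | top => exact absurd h hx
        | coe r => rw [← EReal.coe_mul]; exact EReal.coe_ne_bot _
    lift legendre f x to ℝ using ⟨hx, legendre_ne_bot h1 x⟩ with s hs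
    lift legendre f y to ℝ using ⟨hy, legendre_ne_bot h1 y⟩ with t ht
    rw [← EReal.coe_mul, ← EReal.coe_mul, ← EReal.coe_add]
    refine legendre_le_of_forall fun z r hr => ?_
    have h3 := inner_le_add_of_legendre_le hr hs.ge
    have h4 := inner_le_add_of_legendre_le hr ht.ge
    rw [inner_add_right, inner_smul_right, inner_smul_right]
    have hb' : b = 1 - a := by linarith
    subst hb'
    nlinarith

/-- Hahn–Banach for the closed convex epigraph and a point strictly below it. -/
theorem exists_separation (hf : IsClosedConvex f) (x₀ : Rn n) {a : ℝ} (ha : (a : EReal) < f x₀) :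
    ∃ (y : Rn n) (β u : ℝ), 0 ≤ β ∧ inner ℝ x₀ y + β * a < u ∧
      ∀ x, ∀ t : ℝ, f x ≤ t → u < inner ℝ x y + β * t := by
  set E : Set (Rn n × ℝ) := {p | f p.1 ≤ (p.2 : EReal)}
  have hclosed : IsClosed E :=
    hf.lsc.isClosed_epigraph.preimage
      (continuous_fst.prodMk (continuous_coe_real_ereal.comp continuous_snd))
  have hconv : Convex ℝ E := by
    refine convex_iff_forall_pos.2 ?_
    rintro ⟨x, s⟩ hs ⟨y, t⟩ ht a b ha hb hab
    have hs' : f x ≤ s := hs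
    have ht' : f y ≤ t := ht
    show f (a • x + b • y) ≤ ((a * s + b * t : ℝ) : EReal)
    refine (hf.convex x y a b ha hb hab).trans ?_
    push_cast
    have ha' : (0 : EReal) ≤ a := by exact_mod_cast ha.le
    have hb' : (0 : EReal) ≤ b := by exact_mod_cast hb.le
    gcongr
  have hnot : (x₀, a) ∉ E := not_le.2 ha
  obtain ⟨F, u, h1, h2⟩ := geometric_hahn_banach_point_closed hconv hclosed hnot
  set y := (InnerProductSpace.toDual ℝ (Rn n)).symm (F.comp (ContinuousLinearMap.inl ℝ _ _))
  have hF : ∀ x t, F (x, t) = inner ℝ x y + F (0, 1) * t := by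
    intro x t
    have : (x, t) = (x, (0 : ℝ)) + t • ((0 : Rn n), (1 : ℝ)) := by simp
    rw [this, map_add, map_smul, real_inner_comm, InnerProductSpace.toDual_symm_apply]
    simp [mul_comm]
  refine ⟨y, F (0, 1), u, ?_, by rw [← hF]; exact h1, fun x t hxt => by rw [← hF]; exact h2 _ hxt⟩
  -- A negative vertical coefficient is violated far up in the epigraph, above a point of the
  -- domain.
  by_contra! hneg
  obtain ⟨x₁, hx₁⟩ := hf.exists_lt_top
  lift f x₁ to ℝ using ⟨hx₁.ne, hf.ne_bot x₁⟩ with r hr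
  set t := max r ((u - inner ℝ x₁ y) / F (0, 1))
  have := h2 (x₁, t) (by show f x₁ ≤ (t : EReal); rw [← hr]; exact_mod_cast le_max_left _ _)
  rw [hF] at this
  have h3 : (u - inner ℝ x₁ y) / F (0, 1) ≤ t := le_max_right _ _
  rw [div_le_iff_of_neg hneg] at h3
  linarith

/-- A non-vertical separating hyperplane is the graph of an affine minorant. If it is vertical, a
large multiple of it is added to a minorant found at a point of the domain. -/
theorem exists_affine_minorant (hf : IsClosedConvex f) (x₀ : Rn n) {a : ℝ}
    (ha : (a : EReal) < f x₀) :
    ∃ (y : Rn n) (r : ℝ), legendre f y ≤ r ∧ a ≤ inner ℝ x₀ y - r := by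
  have pos : ∀ (x₀ : Rn n) {a : ℝ} (y : Rn n) (β u : ℝ), 0 < β → inner ℝ x₀ y + β * a < u →
      (∀ x, ∀ t : ℝ, f x ≤ t → u < inner ℝ x y + β * t) →
      ∃ (y : Rn n) (r : ℝ), legendre f y ≤ r ∧ a ≤ inner ℝ x₀ y - r := by
    intro x₀ a y β u hβ h1 h2
    refine ⟨-(β⁻¹ • y), -(u / β), legendre_le_of_forall fun x t ht => ?_, ?_⟩
    · have := h2 x t ht
      rw [inner_neg_right, inner_smul_right]
      field_simp
      linarith
    · rw [inner_neg_right, inner_smul_right]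
      field_simp
      linarith
  obtain ⟨y, β, u, hβ, h1, h2⟩ := exists_separation hf x₀ ha
  rcases hβ.lt_or_eq with hβ | rfl
  · exact pos x₀ y β u hβ h1 h2
  obtain ⟨x₁, hx₁⟩ := hf.exists_lt_top
  lift f x₁ to ℝ using ⟨hx₁.ne, hf.ne_bot x₁⟩ with r hr
  -- Below a point where `f` is finite the hyperplane cannot be vertical: it separates two points of
  -- one vertical line.
  obtain ⟨y', β', u', hβ', h1', h2'⟩ := exists_separation hf x₁ (a := r - 1)
    (by rw [← hr]; exact_mod_cast sub_one_lt r)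
  obtain ⟨z, q, hz, -⟩ := pos x₁ (a := r - 1) y' β' u'
    (by have := h2' x₁ r hr.ge; nlinarith) h1' h2'
  simp only [zero_mul, add_zero] at h1 h2
  set l := max 0 ((a - (inner ℝ x₀ z - q)) / (u - inner ℝ x₀ y))
  have hl0 : 0 ≤ l := le_max_left _ _
  have hl : a - (inner ℝ x₀ z - q) ≤ l * (u - inner ℝ x₀ y) :=
    (div_le_iff₀ (by linarith)).1 (le_max_right _ _)
  refine ⟨z - l • y, q - l * u, legendre_le_of_forall fun x t ht => ?_, ?_⟩
  · have h3 := inner_le_add_of_legendre_le ht hz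
    have h4 := h2 x t ht
    rw [inner_sub_right, inner_smul_right]
    nlinarith
  · rw [inner_sub_right, inner_smul_right]
    linarith

theorem IsClosedConvex.exists_legendre_lt_top (hf : IsClosedConvex f) :
    ∃ y, legendre f y < ⊤ := by
  obtain ⟨x₁, hx₁⟩ := hf.exists_lt_top
  obtain ⟨y, r, h, -⟩ := exists_affine_minorant hf x₁ (a := (f x₁).toReal - 1) (by
    lift f x₁ to ℝ using ⟨hx₁.ne, hf.ne_bot x₁⟩ with r hr
    exact_mod_cast sub_one_lt r)
  exact ⟨y, h.trans_lt (EReal.coe_lt_top r)⟩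

theorem IsClosedConvex.legendre (hf : IsClosedConvex f) : IsClosedConvex (legendre f) :=
  isClosedConvex_legendre hf.exists_lt_top hf.exists_legendre_lt_top

/-- The Fenchel–Moreau theorem. -/
theorem IsClosedConvex.legendre_legendre (hf : IsClosedConvex f) :
    InverseSantalo.legendre (InverseSantalo.legendre f) = f := by
  ext x
  refine le_antisymm (legendre_legendre_le f x) ?_
  refine EReal.ge_of_forall_gt_iff_ge.1 fun a ha => ?_
  obtain ⟨y, r, h1, h2⟩ := exists_affine_minorant hf x ha
  refine le_trans ?_ (inner_sub_le_legendre _ y x)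
  refine le_trans ?_ (EReal.sub_le_sub le_rfl h1)
  rw [real_inner_comm]
  exact_mod_cast h2

theorem IsClosedConvex.measurable (hf : IsClosedConvex f) : Measurable f :=
  hf.lsc.measurable

theorem IsClosedConvex.exists_affine_le (hf : IsClosedConvex f) :
    ∃ (y : Rn n) (r : ℝ), ∀ x, ((inner ℝ x y - r : ℝ) : EReal) ≤ f x := by
  obtain ⟨y, hy⟩ := hf.exists_legendre_lt_top
  refine ⟨y, (InverseSantalo.legendre f y).toReal, legendre_le_iff.1 ?_⟩
  rw [EReal.coe_toReal hy.ne (legendre_ne_bot hf.exists_lt_top y)]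

theorem legendre_comp_isometry {e : Rn n ≃ₗᵢ[ℝ] Rn n} (he : ∀ x, f (e x) = f x) (y : Rn n) :
    legendre f (e y) = legendre f y := by
  unfold legendre
  rw [← e.surjective.iSup_comp]
  simp only [e.inner_map_map, he]

end Legendre

/-! ### Extended real valued integrals -/

section EIntegral

variable {α : Type} [MeasurableSpace α] {μ : Measure α}

theorem eintegral_mono_ae {f g : α → EReal} (h : f ≤ᵐ[μ] g) : eintegral μ f ≤ eintegral μ g := by
  refine EReal.sub_le_sub ?_ ?_
  · exact_mod_cast lintegral_mono_ae (h.mono fun x hx => EReal.toENNReal_le_toENNReal hx)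
  · exact_mod_cast lintegral_mono_ae
      (h.mono fun x hx => EReal.toENNReal_le_toENNReal (EReal.neg_le_neg_iff.2 hx))

theorem eintegral_congr_ae {f g : α → EReal} (h : f =ᵐ[μ] g) : eintegral μ f = eintegral μ g :=
  le_antisymm (eintegral_mono_ae h.le) (eintegral_mono_ae h.symm.le)

theorem eintegral_coe {F : α → ℝ} (hF : Integrable F μ) :
    eintegral μ (fun x => (F x : EReal)) = ((∫ x, F x ∂μ : ℝ) : EReal) := by
  have h1 : ∫⁻ x, ENNReal.ofReal (F x) ∂μ ≠ ∞ := hF.lintegral_lt_top.ne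
  have h2 : ∫⁻ x, ENNReal.ofReal (-F x) ∂μ ≠ ∞ := hF.neg.lintegral_lt_top.ne
  rw [integral_eq_lintegral_pos_part_sub_lintegral_neg_part hF]
  simp only [eintegral, ← EReal.coe_neg, EReal.real_coe_toENNReal]
  lift (∫⁻ x, ENNReal.ofReal (F x) ∂μ) to NNReal using h1 with p
  lift (∫⁻ x, ENNReal.ofReal (-F x) ∂μ) to NNReal using h2 with q
  rfl

/-- The integrable minorant makes the negative part finite. This dichotomy reduces later integrals
either to a trivial case or to Bochner integrals. -/
theorem eintegral_eq_top_or {f : α → EReal} (hf : AEMeasurable f μ) {l : α → ℝ}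
    (hl : Integrable l μ) (hlf : ∀ᵐ x ∂μ, (l x : EReal) ≤ f x) :
    eintegral μ f = ⊤ ∨ ∃ F : α → ℝ, Integrable F μ ∧ f =ᵐ[μ] (fun x => (F x : EReal)) ∧
      eintegral μ f = ((∫ x, F x ∂μ : ℝ) : EReal) := by
  have hneg : ∫⁻ x, (-f x).toENNReal ∂μ ≠ ∞ := by
    refine ne_top_of_le_ne_top hl.neg.lintegral_lt_top.ne (lintegral_mono_ae ?_)
    filter_upwards [hlf] with x hx
    simpa [← EReal.coe_neg] using
      EReal.toENNReal_le_toENNReal (EReal.neg_le_neg_iff.2 hx)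
  by_cases hpos : ∫⁻ x, (f x).toENNReal ∂μ = ∞
  · left
    unfold eintegral
    rw [hpos]
    lift (∫⁻ x, (-f x).toENNReal ∂μ) to NNReal using hneg with q
    rfl
  · right
    have hfin : ∀ᵐ x ∂μ, (f x).toENNReal < ∞ := ae_lt_top' hf.ereal_toENNReal hpos
    have heq : f =ᵐ[μ] fun x => ((f x).toReal : EReal) := by
      filter_upwards [hfin, hlf] with x h1 h2
      refine (EReal.coe_toReal ?_ ?_).symm
      · exact EReal.toENNReal_ne_top_iff.1 h1.ne
      · exact ((EReal.bot_lt_coe _).trans_le h2).ne'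
    have hint : Integrable (fun x => (f x).toReal) μ := by
      refine ⟨hf.ereal_toReal.aestronglyMeasurable, ?_⟩
      refine lt_of_le_of_lt (lintegral_mono_ae (g := fun x => (f x).toENNReal + (-f x).toENNReal) ?_)
        ?_
      · filter_upwards [heq] with x hx
        rw [hx, EReal.toReal_coe, ← EReal.coe_neg, EReal.real_coe_toENNReal,
          EReal.real_coe_toENNReal, Real.enorm_eq_ofReal_abs]
        rcases le_total 0 (f x).toReal with h | h
        · rw [abs_of_nonneg h]; exact le_self_add
        · rw [abs_of_nonpos h]; exact le_add_self
      · rw [lintegral_add_left' hf.ereal_toENNReal]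
        exact ENNReal.add_lt_top.2 ⟨lt_top_iff_ne_top.2 hpos, lt_top_iff_ne_top.2 hneg⟩
    exact ⟨_, hint, heq, by rw [eintegral_congr_ae heq, eintegral_coe hint]⟩

theorem le_eintegral {f : α → EReal} {l : α → ℝ} (hl : Integrable l μ)
    (hlf : ∀ᵐ x ∂μ, (l x : EReal) ≤ f x) : ((∫ x, l x ∂μ : ℝ) : EReal) ≤ eintegral μ f := by
  rw [← eintegral_coe hl]
  exact eintegral_mono_ae hlf

theorem eintegral_ne_bot {f : α → EReal} {l : α → ℝ} (hl : Integrable l μ)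
    (hlf : ∀ᵐ x ∂μ, (l x : EReal) ≤ f x) : eintegral μ f ≠ ⊥ :=
  ((EReal.bot_lt_coe _).trans_le (le_eintegral hl hlf)).ne'

end EIntegral

/-! ### Entropy and the lower Gibbs bound -/

section Entropy

variable {n : ℕ} {η : Measure (Rn n)}

theorem coe_mul_log_eq {a : ℝ≥0∞} (ha : a ≠ ∞) :
    (a : EReal) * ENNReal.log a = ((a.toReal * Real.log a.toReal : ℝ) : EReal) := by
  by_cases h0 : a = 0
  · simp [h0]
  · rw [ENNReal.log_pos_real h0 ha, EReal.coe_mul, EReal.coe_ennreal_toReal ha]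

/-- From log t ≤ t - 1 at t = p / h: the pointwise form of the nonnegativity of relative entropy. -/
theorem mul_log_ge {h p : ℝ} (hh : 0 ≤ h) (hp : 0 < p) : h * Real.log p + h - p ≤ h * Real.log h := by
  rcases hh.eq_or_lt with rfl | hh
  · simp [hp.le]
  · have h1 := Real.log_le_sub_one_of_pos (div_pos hp hh)
    rw [Real.log_div hp.ne' hh.ne'] at h1
    have h2 := mul_le_mul_of_nonneg_left h1 hh.le
    have h3 : h * (p / h - 1) = p - h := by field_simp
    linarith

theorem integrable_norm_mul_rnDeriv (hη : η ∈ P1 n) (hac : η ≪ volume) :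
    Integrable (fun x => (η.rnDeriv volume x).toReal * ‖x‖) volume := by
  have := hη.1
  exact (integrable_rnDeriv_smul_iff hac).2 hη.2

/-- Comparison with the integrable function p = (1 + ‖x‖)^{-(n+1)}: since log p ≥ -(n+1)‖x‖, the
finite first moment controls the negative part of h log h. -/
theorem entropy_density_ge (hη : η ∈ P1 n) (hac : η ≪ volume) :
    ∃ l : Rn n → ℝ, Integrable l volume ∧ ∀ᵐ x ∂(volume : Measure (Rn n)), (l x : EReal) ≤
      ((η.rnDeriv volume x : ENNReal) : EReal) * ENNReal.log (η.rnDeriv volume x) := by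
  have := hη.1
  set r : ℝ := n + 1
  refine ⟨fun x => -(r * ((η.rnDeriv volume x).toReal * ‖x‖)) - (1 + ‖x‖) ^ (-r), ?_, ?_⟩
  · refine ((integrable_norm_mul_rnDeriv hη hac).const_mul r).neg.sub ?_
    exact integrable_one_add_norm (by simp [r])
  · filter_upwards [η.rnDeriv_lt_top volume] with x hx
    rw [coe_mul_log_eq hx.ne, EReal.coe_le_coe_iff]
    set h := (η.rnDeriv volume x).toReal
    have hh : 0 ≤ h := ENNReal.toReal_nonneg
    have hx1 : 0 < 1 + ‖x‖ := by positivity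
    have h1 := mul_log_ge hh (Real.rpow_pos_of_pos hx1 (-r))
    rw [Real.log_rpow hx1] at h1
    have h2 : Real.log (1 + ‖x‖) ≤ ‖x‖ := by
      have := Real.log_le_sub_one_of_pos hx1
      linarith
    have h3 : h * (r * Real.log (1 + ‖x‖)) ≤ h * (r * ‖x‖) := by
      gcongr
    linarith

theorem measurable_entropy_density :
    Measurable fun x => ((η.rnDeriv volume x : ENNReal) : EReal) *
      ENNReal.log (η.rnDeriv volume x) :=
  (η.measurable_rnDeriv volume).coe_ereal_ennreal.mul (η.measurable_rnDeriv volume).ennreal_log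

theorem entropyLeb_eq_top_or (hη : η ∈ P1 n) : entropyLeb η = ⊤ ∨ η ≪ volume ∧
    Integrable (fun x => (η.rnDeriv volume x).toReal * Real.log (η.rnDeriv volume x).toReal)
      volume ∧
    entropyLeb η = ((∫ x, (η.rnDeriv volume x).toReal *
      Real.log (η.rnDeriv volume x).toReal : ℝ) : EReal) := by
  have := hη.1
  unfold entropyLeb
  by_cases hac : η ≪ volume
  · rw [if_pos hac]
    obtain ⟨l, hl, hle⟩ := entropy_density_ge hη hac
    refine (eintegral_eq_top_or measurable_entropy_density.aemeasurable hl hle).imp id ?_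
    rintro ⟨F, hF, hEF, hi⟩
    have : F =ᵐ[volume]
        fun x => (η.rnDeriv volume x).toReal * Real.log (η.rnDeriv volume x).toReal := by
      filter_upwards [hEF, η.rnDeriv_lt_top volume] with x h1 h2
      rw [coe_mul_log_eq h2.ne] at h1
      exact_mod_cast h1.symm
    exact ⟨hac, hF.congr this, by rw [hi, integral_congr_ae this]⟩
  · simp [hac]

theorem entropyLeb_ne_bot (hη : η ∈ P1 n) : entropyLeb η ≠ ⊥ := by
  rcases entropyLeb_eq_top_or hη with h | ⟨-, -, h⟩ <;> rw [h]
  · exact top_ne_bot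
  · exact EReal.coe_ne_bot _

theorem integrable_affine (hη : η ∈ P1 n) (y : Rn n) (r : ℝ) :
    Integrable (fun x => inner ℝ x y - r) η := by
  have := hη.1
  refine Integrable.sub ?_ (integrable_const r)
  refine (hη.2.mul_const ‖y‖).mono' (by fun_prop) (ae_of_all _ fun x => ?_)
  exact norm_inner_le_norm x y

theorem IsClosedConvex.eintegral_eq_top_or {f : Rn n → EReal} (hf : IsClosedConvex f)
    (hη : η ∈ P1 n) : eintegral η f = ⊤ ∨ ∃ F : Rn n → ℝ, Integrable F η ∧
      f =ᵐ[η] (fun x => (F x : EReal)) ∧ eintegral η f = ((∫ x, F x ∂η : ℝ) : EReal) := by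
  obtain ⟨y, r, h⟩ := hf.exists_affine_le
  exact InverseSantalo.eintegral_eq_top_or hf.measurable.aemeasurable (integrable_affine hη y r)
    (ae_of_all _ h)

theorem IsClosedConvex.eintegral_ne_bot {f : Rn n → EReal} (hf : IsClosedConvex f)
    (hη : η ∈ P1 n) : eintegral η f ≠ ⊥ := by
  obtain ⟨y, r, h⟩ := hf.exists_affine_le
  exact InverseSantalo.eintegral_ne_bot (integrable_affine hη y r) (ae_of_all _ h)

/-- One half of the Gibbs variational principle. -/
theorem neg_log_le_eintegral_add_entropyLeb (hη : η ∈ P1 n) {g : Rn n → EReal}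
    (hg : IsClosedConvex g) {C : ℝ} (hC : 0 < C) (hgC : expInt g ≤ ENNReal.ofReal C) :
    ((-Real.log C : ℝ) : EReal) ≤ eintegral η g + entropyLeb η := by
  have := hη.1
  rcases hg.eintegral_eq_top_or hη with h | ⟨G, hG, hgG, hi⟩
  · rw [h, EReal.top_add_of_ne_bot (entropyLeb_ne_bot hη)]
    exact le_top
  rcases entropyLeb_eq_top_or hη with h | ⟨hac, hE, hi'⟩
  · rw [h, EReal.add_top_of_ne_bot (hg.eintegral_ne_bot hη)]
    exact le_top
  rw [hi, hi', ← EReal.coe_add, EReal.coe_le_coe_iff]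
  set h : Rn n → ℝ := fun x => (η.rnDeriv volume x).toReal
  have hh0 : ∀ x, 0 ≤ h x := fun x => ENNReal.toReal_nonneg
  have hhint : Integrable h volume := Measure.integrable_toReal_rnDeriv
  have hh1 : ∫ x, h x = 1 := by
    simp only [h]
    rw [Measure.integral_toReal_rnDeriv hac, probReal_univ]
  have hGint : Integrable (fun x => h x * G x) volume := (integrable_rnDeriv_smul_iff hac).2 hG
  have hGeq : ∫ x, G x ∂η = ∫ x, h x * G x := (integral_rnDeriv_smul hac).symm
  set q : Rn n → ℝ := fun x => (EReal.exp (-g x)).toReal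
  have hgm : Measurable fun x => EReal.exp (-g x) := hg.measurable.neg.ereal_exp
  have hgt : ∫⁻ x, EReal.exp (-g x) ≠ ∞ := ne_top_of_le_ne_top ENNReal.ofReal_ne_top hgC
  have hqint : Integrable q volume := integrable_toReal_of_lintegral_ne_top hgm.aemeasurable hgt
  have hqC : ∫ x, q x ≤ C := by
    simp only [q]
    rw [integral_toReal hgm.aemeasurable (ae_lt_top hgm hgt)]
    exact ENNReal.toReal_le_of_le_ofReal hC.le hgC
  have hpt : ∀ᵐ x ∂(volume : Measure (Rn n)), h x * -Real.log C + h x - q x / C ≤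
      h x * Real.log (h x) + h x * G x := by
    -- `g` and `G` agree only η-almost everywhere, hence almost everywhere on {h ≠ 0}; where h = 0
    -- the left side is nonpositive and the right side is zero. Elsewhere `mul_log_ge` is applied
    -- with p = e^{-G} / C.
    filter_upwards [Measure.ae_rnDeriv_ne_zero_imp_of_ae volume hgG] with x hx
    rcases (hh0 x).eq_or_lt with h0 | h0
    · rw [← h0]
      have : 0 ≤ q x / C := div_nonneg ENNReal.toReal_nonneg hC.le
      simp only [zero_mul]
      linarith
    · have hx' := hx (fun h1 => by simp [h, h1] at h0)
      have hq : q x = Real.exp (-G x) := by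
        simp only [q]
        rw [hx', ← EReal.coe_neg, EReal.exp_coe, ENNReal.toReal_ofReal (Real.exp_pos _).le]
      have h1 := mul_log_ge h0.le (div_pos (Real.exp_pos (-G x)) hC)
      rw [Real.log_div (Real.exp_pos _).ne' hC.ne', Real.log_exp] at h1
      rw [hq]
      linarith
  have hA : Integrable (fun x => h x * -Real.log C + h x) volume := (hhint.mul_const _).add hhint
  have hfin : ∫ x, (h x * -Real.log C + h x - q x / C) ≤
      ∫ x, (h x * Real.log (h x) + h x * G x) :=
    integral_mono_ae (hA.sub (hqint.div_const C)) (hE.add hGint) hpt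
  rw [integral_sub hA (hqint.div_const C), integral_add (hhint.mul_const _) hhint,
    integral_add hE hGint, integral_mul_const, integral_div, hh1] at hfin
  have hdiv : (∫ x, q x) / C ≤ 1 := (div_le_one hC).2 hqC
  rw [hGeq]
  linarith

end Entropy

/-! ### Group invariance and the upper Gibbs bound -/

section Invariance

variable {n : ℕ} {Γ : Type*} [Group Γ] (ρ : Γ →* (Rn n ≃ₗᵢ[ℝ] Rn n))

/-- The functions that are invariant under a group of linear isometries. -/
def IsInvFun (f : Rn n → EReal) : Prop := ∀ γ x, f (ρ γ x) = f x

/-- The elements of `𝓟₁(ℝⁿ)` that are invariant under a group of linear isometries. -/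
def P1inv : Set (Measure (Rn n)) := {ν | ν ∈ P1 n ∧ ∀ γ, ν.map (ρ γ) = ν}

variable {ρ}

theorem IsInvFun.legendre {f : Rn n → EReal} (hf : IsInvFun ρ f) : IsInvFun ρ (legendre f) :=
  fun γ y => legendre_comp_isometry (hf γ) y

theorem map_withDensity_of_invariant {d : Rn n → ℝ≥0∞} (hd : Measurable d)
    (e : Rn n ≃ₗᵢ[ℝ] Rn n) (h : ∀ x, d (e x) = d x) :
    ((volume : Measure (Rn n)).withDensity d).map e = volume.withDensity d := by
  have he : MeasurePreserving e := e.measurePreserving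
  ext s hs
  rw [Measure.map_apply he.measurable hs, withDensity_apply _ hs,
    withDensity_apply _ (he.measurable hs), ← lintegral_indicator hs,
    ← lintegral_indicator (he.measurable hs), ← he.lintegral_comp (hd.indicator hs)]
  refine lintegral_congr fun x => ?_
  by_cases hx : e x ∈ s
  · rw [indicator_of_mem hx, indicator_of_mem (show x ∈ e ⁻¹' s from hx), h]
  · rw [indicator_of_notMem hx, indicator_of_notMem (show x ∉ e ⁻¹' s from hx)]

/-- Exhaustion by bounded sets on which `g` is bounded above. A Gibbs measure restricted to such a
set has finite energy, entropy and first moment even if the full integral is infinite. -/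
theorem expInt_eq_iSup {g : Rn n → EReal} (hg : Measurable g) :
    expInt g = ⨆ k : ℕ, ∫⁻ y in {y | ‖y‖ ≤ k ∧ g y ≤ (k : ℝ)}, EReal.exp (-g y) := by
  have hS : ∀ k : ℕ, MeasurableSet {y : Rn n | ‖y‖ ≤ k ∧ g y ≤ (k : ℝ)} := fun k =>
    (measurableSet_le measurable_norm measurable_const).inter
      (measurableSet_le hg measurable_const)
  have hm : Measurable fun y => EReal.exp (-g y) := hg.neg.ereal_exp
  simp only [← lintegral_indicator (hS _)]
  rw [← lintegral_iSup fun k => hm.indicator (hS k)]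
  · refine lintegral_congr fun y => le_antisymm ?_ (iSup_le fun k => indicator_le_self _ _ y)
    by_cases hy : g y = ⊤
    · simp [hy]
    obtain ⟨k, hk⟩ := exists_nat_ge (max ‖y‖ (g y).toReal)
    refine le_trans ?_ (le_iSup _ k)
    rw [indicator_of_mem]
    refine ⟨(le_max_left _ _).trans hk, (EReal.le_coe_toReal hy).trans ?_⟩
    exact_mod_cast (le_max_right _ _).trans hk
  · intro j k hjk
    refine indicator_le_indicator_of_subset ?_ (fun _ => zero_le)
    rintro y ⟨h1, h2⟩
    have : (j : ℝ) ≤ k := by exact_mod_cast hjk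
    exact ⟨h1.trans this, h2.trans (by exact_mod_cast this)⟩

/-- The other half of the Gibbs variational principle. -/
theorem exists_eintegral_add_entropyLeb_le {g : Rn n → EReal} (hg : IsClosedConvex g)
    (hinv : IsInvFun ρ g) {a : ℝ} (ha : 0 < a) (hag : ENNReal.ofReal a < expInt g) :
    ∃ η ∈ P1inv ρ, eintegral η g + entropyLeb η ≤ ((-Real.log a : ℝ) : EReal) := by
  rw [expInt_eq_iSup hg.measurable, lt_iSup_iff] at hag
  obtain ⟨k, hk⟩ := hag
  set S : Set (Rn n) := {y | ‖y‖ ≤ k ∧ g y ≤ (k : ℝ)}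
  have hS : MeasurableSet S := (measurableSet_le measurable_norm measurable_const).inter
      (measurableSet_le hg.measurable measurable_const)
  have hSfin : volume S ≠ ∞ := by
    refine ne_top_of_le_ne_top (measure_closedBall_lt_top (x := (0 : Rn n)) (r := k)).ne
      (measure_mono fun y hy => ?_)
    simpa using hy.1
  obtain ⟨y₀, r, haff⟩ := hg.exists_affine_le
  set G : Rn n → ℝ := fun y => (g y).toReal
  have hGm : Measurable G := hg.measurable.ereal_toReal
  have hgG : ∀ y ∈ S, g y = (G y : EReal) := fun y hy =>
    (EReal.coe_toReal (hy.2.trans_lt (EReal.coe_lt_top _)).ne (hg.ne_bot y)).symm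
  set K : ℝ := k + k * ‖y₀‖ + |r|
  have hGK : ∀ y ∈ S, |G y| ≤ K := by
    intro y hy
    have h1 : G y ≤ k := by
      have := hy.2
      rw [hgG y hy] at this
      exact_mod_cast this
    have h2 : inner ℝ y y₀ - r ≤ G y := by
      have := haff y
      rw [hgG y hy] at this
      exact_mod_cast this
    have h3 : |inner ℝ y y₀| ≤ k * ‖y₀‖ :=
      (abs_real_inner_le_norm y y₀).trans (by gcongr; exact hy.1)
    have h4 := (abs_le.1 h3).1
    have h5 := le_abs_self r
    have h6 : 0 ≤ |r| := abs_nonneg r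
    have h7 : (0 : ℝ) ≤ k := Nat.cast_nonneg k
    have h8 : 0 ≤ k * ‖y₀‖ := by positivity
    rw [abs_le]
    constructor <;> simp only [K] <;> linarith
  have hbdd : ∀ {φ : Rn n → ℝ}, Measurable φ → ∀ c, (∀ y ∈ S, |φ y| ≤ c) →
      IntegrableOn φ S volume := by
    intro φ hφ c hc
    refine Measure.integrableOn_of_bounded (M := c) hSfin hφ.aestronglyMeasurable ?_
    exact (ae_restrict_iff' hS).2 (ae_of_all _ hc)
  set q : Rn n → ℝ := fun y => Real.exp (-G y)
  have hqm : Measurable q := hGm.neg.exp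
  have hqK : ∀ y ∈ S, |q y| ≤ Real.exp K := by
    intro y hy
    rw [abs_of_pos (Real.exp_pos _)]
    exact Real.exp_le_exp.2 ((neg_le_abs _).trans (hGK y hy))
  have hqint := hbdd hqm _ hqK
  set Z : ℝ := ∫ y in S, q y
  have hZ : ENNReal.ofReal Z = ∫⁻ y in S, EReal.exp (-g y) := by
    rw [ofReal_integral_eq_lintegral_ofReal hqint (ae_of_all _ fun y => (Real.exp_pos _).le)]
    refine setLIntegral_congr_fun hS fun y hy => ?_
    simp only [q]
    rw [hgG y hy, ← EReal.coe_neg, EReal.exp_coe]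
  have haZ : a < Z := by
    rw [← hZ] at hk
    exact (ENNReal.ofReal_lt_ofReal_iff_of_nonneg ha.le).1 hk
  have hZ0 : 0 < Z := ha.trans haZ
  set hd : Rn n → ℝ := S.indicator fun y => q y / Z
  have hdm : Measurable hd := (hqm.div_const Z).indicator hS
  have hd0 : ∀ y, 0 ≤ hd y := fun y =>
    indicator_nonneg (fun y _ => div_nonneg (Real.exp_pos _).le hZ0.le) y
  have hdint : Integrable hd volume := (integrable_indicator_iff hS).2 (hqint.div_const Z)
  have hd1 : ∫ y, hd y = 1 := by
    simp only [hd]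
    rw [integral_indicator hS, integral_div, div_self hZ0.ne']
  set η : Measure (Rn n) := volume.withDensity fun y => ENNReal.ofReal (hd y)
  have hac : η ≪ volume := withDensity_absolutelyContinuous _ _
  have hprob : IsProbabilityMeasure η := by
    refine ⟨?_⟩
    simp only [η]
    rw [withDensity_apply _ MeasurableSet.univ, setLIntegral_univ,
      ← ofReal_integral_eq_lintegral_ofReal hdint (ae_of_all _ hd0), hd1, ENNReal.ofReal_one]
  have hηS : ∀ᵐ y ∂η, y ∈ S := by
    rw [ae_iff]
    show η Sᶜ = 0
    simp only [η]
    rw [withDensity_apply _ hS.compl]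
    refine (setLIntegral_congr_fun hS.compl fun y hy => ?_).trans lintegral_zero
    simp [hd, indicator_of_notMem hy]
  have hP1 : η ∈ P1 n := by
    refine ⟨hprob, Integrable.of_bound (C := k) (by fun_prop) ?_⟩
    filter_upwards [hηS] with y hy
    simpa using hy.1
  -- The truncation uses only the norm and `g`, so it preserves the symmetry.
  have hSinv : ∀ γ y, ρ γ y ∈ S ↔ y ∈ S := by
    intro γ y
    simp only [S, mem_ofPred_eq, LinearIsometryEquiv.norm_map, hinv γ y]
  have hηinv : η ∈ P1inv ρ := by
    refine ⟨hP1, fun γ => map_withDensity_of_invariant hdm.ennreal_ofReal _ fun y => ?_⟩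
    by_cases hy : y ∈ S
    · simp only [hd, indicator_of_mem hy, indicator_of_mem ((hSinv γ y).2 hy), q, G, hinv γ y]
    · simp only [hd, indicator_of_notMem hy, indicator_of_notMem (mt (hSinv γ y).1 hy)]
  refine ⟨η, hηinv, ?_⟩
  have hrn : η.rnDeriv volume =ᵐ[volume] fun y => ENNReal.ofReal (hd y) :=
    Measure.rnDeriv_withDensity volume hdm.ennreal_ofReal
  set φ : Rn n → ℝ := fun y => q y / Z * (-G y - Real.log Z)
  set ψ : Rn n → ℝ := fun y => q y / Z * G y
  have hφm : Measurable φ := (hqm.div_const Z).mul (hGm.neg.sub_const _)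
  have hψm : Measurable ψ := (hqm.div_const Z).mul hGm
  have hqZ : ∀ y ∈ S, |q y / Z| ≤ Real.exp K / Z := fun y hy => by
    rw [abs_div, abs_of_pos hZ0]
    exact div_le_div_of_nonneg_right (hqK y hy) hZ0.le
  have hφint : IntegrableOn φ S volume := by
    refine hbdd hφm (Real.exp K / Z * (K + |Real.log Z|)) fun y hy => ?_
    rw [abs_mul]
    refine mul_le_mul (hqZ y hy) ?_ (abs_nonneg _) (by positivity)
    refine (abs_sub _ _).trans ?_
    rw [abs_neg]
    exact add_le_add_left (hGK y hy) _
  have hψint : IntegrableOn ψ S volume := by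
    refine hbdd hψm (Real.exp K / Z * K) fun y hy => ?_
    rw [abs_mul]
    exact mul_le_mul (hqZ y hy) (hGK y hy) (abs_nonneg _) (by positivity)
  have hent : entropyLeb η = ((∫ y in S, φ y : ℝ) : EReal) := by
    unfold entropyLeb
    rw [if_pos hac, ← integral_indicator hS, ← eintegral_coe ((integrable_indicator_iff hS).2 hφint)]
    refine eintegral_congr_ae ?_
    filter_upwards [hrn] with y hy
    rw [hy, coe_mul_log_eq ENNReal.ofReal_ne_top, ENNReal.toReal_ofReal (hd0 y)]
    by_cases hyS : y ∈ S
    · simp only [hd, indicator_of_mem hyS, φ]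
      rw [Real.log_div (Real.exp_pos _).ne' hZ0.ne', Real.log_exp]
    · simp [hd, indicator_of_notMem hyS]
  have hdG : ∀ y, (ENNReal.ofReal (hd y)).toReal • G y = S.indicator ψ y := by
    intro y
    rw [ENNReal.toReal_ofReal (hd0 y)]
    by_cases hyS : y ∈ S
    · simp [hd, indicator_of_mem hyS, ψ]
    · simp [hd, indicator_of_notMem hyS]
  have hGη : Integrable G η := by
    refine Integrable.of_bound (C := K) hGm.aestronglyMeasurable ?_
    filter_upwards [hηS] with y hy using hGK y hy
  have heint : eintegral η g = ((∫ y in S, ψ y : ℝ) : EReal) := by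
    have : g =ᵐ[η] fun y => (G y : EReal) := by
      filter_upwards [hηS] with y hy using hgG y hy
    rw [eintegral_congr_ae this, eintegral_coe hGη]
    simp only [η]
    rw [integral_withDensity_eq_integral_toReal_smul hdm.ennreal_ofReal
      (ae_of_all _ fun _ => ENNReal.ofReal_lt_top)]
    simp only [hdG]
    rw [integral_indicator hS]
  rw [hent, heint, ← EReal.coe_add, EReal.coe_le_coe_iff, ← integral_add hψint hφint]
  -- The log-density is -G - log Z, so energy plus entropy is exactly -log Z.
  have hsum : ∀ y, ψ y + φ y = q y / Z * -Real.log Z := fun y => by simp only [ψ, φ]; ring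
  simp only [hsum]
  rw [integral_mul_const, integral_div, div_self hZ0.ne', one_mul]
  exact neg_le_neg (Real.log_le_log ha haZ.le)

end Invariance

/-! ### From the inverse Santaló inequality to transport-entropy -/

section Regularization

variable {n : ℕ} {Γ : Type*} [Group Γ] {ρ : Γ →* (Rn n ≃ₗᵢ[ℝ] Rn n)}

theorem expInt_pos {f : Rn n → EReal} (hf : Measurable f) {s : Set (Rn n)} (hs : volume s ≠ 0)
    (h : ∀ x ∈ s, f x ≠ ⊤) : 0 < expInt f := by
  rw [pos_iff_ne_zero]
  intro h0
  unfold expInt at h0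
  have hm : Measurable fun x => EReal.exp (-f x) := hf.neg.ereal_exp
  rw [lintegral_eq_zero_iff hm] at h0
  refine hs (measure_mono_null (fun x hx => ?_) (ae_iff.1 h0))
  simpa using h x hx

/-- Use `g` as the competitor in the transport cost and a nearly optimal Gibbs measure of g* as η.
-/
theorem infTransportEntropy_le {ν : Measure (Rn n)} {g : Rn n → EReal} (hg : IsClosedConvex g)
    (hinv : IsInvFun ρ g) {I a : ℝ} (hI : eintegral ν g ≤ I) (ha : 0 < a)
    (hag : ENNReal.ofReal a < expInt (legendre g)) :
    infTransportEntropy (P1inv ρ) ν ≤ ((I - Real.log a : ℝ) : EReal) := by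
  obtain ⟨η, hη, h⟩ := exists_eintegral_add_entropyLeb_le hg.legendre hinv.legendre ha hag
  refine (iInf₂_le η hη).trans ?_
  calc maxCorr ν η + entropyLeb η
      ≤ eintegral ν g + eintegral η (legendre g) + entropyLeb η := by
        gcongr
        exact iInf₂_le g hg
    _ = eintegral ν g + (eintegral η (legendre g) + entropyLeb η) := add_assoc _ _ _
    _ ≤ (I : EReal) + ((-Real.log a : ℝ) : EReal) := add_le_add hI h
    _ = _ := by rw [← EReal.coe_add, sub_eq_add_neg]

theorem infTransportEntropy_add_le {ν₁ ν₂ : Measure (Rn n)} {g : Rn n → EReal}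
    (hg : IsClosedConvex g) (hinv : IsInvFun ρ g) {I₁ I₂ c : ℝ} (hc : 0 < c)
    (hI₁ : eintegral ν₁ (legendre g) ≤ I₁)
    (hI₂ : eintegral ν₂ g ≤ I₂) (h₁ : 0 < expInt g) (h₂ : 0 < expInt (legendre g))
    (h : ENNReal.ofReal c ^ n ≤ expInt g * expInt (legendre g)) :
    infTransportEntropy (P1inv ρ) ν₁ + infTransportEntropy (P1inv ρ) ν₂ ≤
      ((I₁ + I₂ - n * Real.log c : ℝ) : EReal) := by
  set K := infTransportEntropy (P1inv ρ) ν₁ + infTransportEntropy (P1inv ρ) ν₂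
  have hK : ∀ a b : ℝ, 0 < a → 0 < b → ENNReal.ofReal a < expInt g →
      ENNReal.ofReal b < expInt (legendre g) → K ≤ ((I₁ + I₂ - Real.log (a * b) : ℝ) : EReal) := by
    intro a b ha hb hag hbg
    have k1 := infTransportEntropy_le (ρ := ρ) (ν := ν₁) hg.legendre hinv.legendre hI₁ ha
      (by rwa [hg.legendre_legendre])
    have k2 := infTransportEntropy_le (ρ := ρ) hg hinv hI₂ hb hbg
    refine (add_le_add k1 k2).trans (le_of_eq ?_)
    rw [← EReal.coe_add, Real.log_mul ha.ne' hb.ne']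
    congr 1
    ring
  have hex : ∀ {P : ℝ≥0∞}, 0 < P → ∃ a : ℝ, 0 < a ∧ ENNReal.ofReal a < P := by
    intro P hP
    obtain ⟨a, ha0, haP⟩ := ENNReal.lt_iff_exists_nnreal_btwn.1 hP
    exact ⟨a, by exact_mod_cast ha0, by simpa using haP⟩
  induction hKv : K with
  | bot => exact bot_le
  | top =>
    obtain ⟨a, ha, hag⟩ := hex h₁
    obtain ⟨b, hb, hbg⟩ := hex h₂
    have := hK a b ha hb hag hbg
    rw [hKv, top_le_iff] at this
    exact absurd this (EReal.coe_ne_top _)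
  | coe κ =>
    rw [EReal.coe_le_coe_iff]
    -- Passing to products of strictly smaller factors covers integrals that may be infinite.
    have hprod : expInt g * expInt (legendre g) ≤ ENNReal.ofReal (Real.exp (I₁ + I₂ - κ)) := by
      refine ENNReal.mul_le_of_forall_lt fun a ha b hb => ?_
      by_cases ha0 : a = 0
      · simp [ha0]
      by_cases hb0 : b = 0
      · simp [hb0]
      have hat := ne_top_of_lt ha
      have hbt := ne_top_of_lt hb
      have ha1 := ENNReal.toReal_pos ha0 hat
      have hb1 := ENNReal.toReal_pos hb0 hbt
      have h3 := hK a.toReal b.toReal ha1 hb1 (by rwa [ENNReal.ofReal_toReal hat])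
        (by rwa [ENNReal.ofReal_toReal hbt])
      rw [hKv, EReal.coe_le_coe_iff] at h3
      rw [← ENNReal.ofReal_toReal hat, ← ENNReal.ofReal_toReal hbt, ← ENNReal.ofReal_mul ha1.le]
      refine ENNReal.ofReal_le_ofReal ?_
      rw [← Real.log_le_iff_le_exp (mul_pos ha1 hb1)]
      linarith
    have h4 := h.trans hprod
    rw [← ENNReal.ofReal_pow hc.le, ENNReal.ofReal_le_ofReal_iff (Real.exp_pos _).le,
      ← Real.log_le_iff_le_exp (pow_pos hc n), Real.log_pow] at h4
    linarith

variable [Fintype Γ]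

variable (ρ) in
/-- The average of a function over the orbits of a finite group. -/
noncomputable def orbitAvg (F : Rn n → ℝ) (x : Rn n) : ℝ :=
  (Fintype.card Γ : ℝ)⁻¹ * ∑ γ, F (ρ γ x)

theorem orbitAvg_apply_map (F : Rn n → ℝ) (γ : Γ) (x : Rn n) :
    orbitAvg ρ F (ρ γ x) = orbitAvg ρ F x := by
  unfold orbitAvg
  rw [← Equiv.sum_comp (Equiv.mulRight γ) fun γ' => F (ρ γ' x)]
  simp

theorem inner_le_orbitAvg_add {F G : Rn n → ℝ} {x y : Rn n}
    (h : ∀ γ, inner ℝ (ρ γ x) (ρ γ y) ≤ F (ρ γ x) + G (ρ γ y)) :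
    inner ℝ x y ≤ orbitAvg ρ F x + orbitAvg ρ G y := by
  have hN : (0 : ℝ) < Fintype.card Γ := by exact_mod_cast Fintype.card_pos
  have h1 := Finset.sum_le_sum fun γ (_ : γ ∈ Finset.univ) => h γ
  simp only [LinearIsometryEquiv.inner_map_map, Finset.sum_const, Finset.card_univ,
    nsmul_eq_mul, Finset.sum_add_distrib] at h1
  unfold orbitAvg
  rw [← mul_add, le_inv_mul_iff₀ hN]
  exact h1

theorem orbitAvg_congr {F G : Rn n → ℝ} {x : Rn n} (h : ∀ γ, F (ρ γ x) = G (ρ γ x)) :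
    orbitAvg ρ F x = orbitAvg ρ G x := by
  unfold orbitAvg
  simp only [h]

theorem integrable_orbitAvg {ν : Measure (Rn n)} (hν : ν ∈ P1inv ρ) {F : Rn n → ℝ}
    (hF : Integrable F ν) : Integrable (orbitAvg ρ F) ν ∧ ∫ x, orbitAvg ρ F x ∂ν = ∫ x, F x ∂ν := by
  have hmp : ∀ γ, MeasurePreserving (ρ γ) ν ν := fun γ => ⟨(ρ γ).continuous.measurable, hν.2 γ⟩
  have hint : ∀ γ, Integrable (fun x => F (ρ γ x)) ν := fun γ =>
    (hmp γ).integrable_comp_of_integrable hF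
  have heq : ∀ γ, ∫ x, F (ρ γ x) ∂ν = ∫ x, F x ∂ν := fun γ =>
    (hmp γ).integral_comp (ρ γ).toHomeomorph.measurableEmbedding F
  have hN : (Fintype.card Γ : ℝ) ≠ 0 := by exact_mod_cast Fintype.card_ne_zero
  unfold orbitAvg
  refine ⟨(integrable_finsetSum _ fun γ _ => hint γ).const_mul _, ?_⟩
  rw [integral_const_mul, integral_finsetSum _ fun γ _ => hint γ]
  simp only [heq, Finset.sum_const, Finset.card_univ, nsmul_eq_mul]
  field_simp

/-- Adding ε‖·‖ to a function lets its conjugate spread over balls of radius ε. This is done once on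
each side, after averaging over orbits, so that g and g* become finite on balls while exceeding the
averages of f* and f by at most ε‖·‖. Infinite values are handled by keeping only points whose whole
orbit is finite. -/
theorem exists_regularization {f : Rn n → EReal} {ε : ℝ} (hε : 0 < ε)
    (hx : ∃ x, ∀ γ, f (ρ γ x) ≠ ⊤) (hy : ∃ y, ∀ γ, legendre f (ρ γ y) ≠ ⊤)
    (hf : ∀ x, f x ≠ ⊥) :
    ∃ g : Rn n → EReal, IsClosedConvex g ∧ IsInvFun ρ g ∧ 0 < expInt g ∧
      0 < expInt (legendre g) ∧
      (∀ y, (∀ γ, legendre f (ρ γ y) ≠ ⊤) →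
        g y ≤ ((orbitAvg ρ (fun y => (legendre f y).toReal) y + ε * ‖y‖ : ℝ) : EReal)) ∧
      (∀ x, (∀ γ, f (ρ γ x) ≠ ⊤) →
        legendre g x ≤ ((orbitAvg ρ (fun x => (f x).toReal) x + ε * ‖x‖ : ℝ) : EReal)) := by
  classical
  obtain ⟨x₀, hx₀⟩ := hx
  obtain ⟨y₀, hy₀⟩ := hy
  set a : Rn n → ℝ := orbitAvg ρ fun x => (f x).toReal
  set b : Rn n → ℝ := orbitAvg ρ fun y => (legendre f y).toReal
  have hlb : ∀ y, legendre f y ≠ ⊥ := legendre_ne_bot ⟨_, (hx₀ 1).lt_top⟩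
  have hab : ∀ x y, (∀ γ, f (ρ γ x) ≠ ⊤) → (∀ γ, legendre f (ρ γ y) ≠ ⊤) →
      inner ℝ x y ≤ a x + b y := fun x y h1 h2 =>
    inner_le_orbitAvg_add fun γ => inner_le_add_of_legendre_le (f := f)
      (EReal.coe_toReal (h1 γ) (hf _)).ge (EReal.coe_toReal (h2 γ) (hlb _)).ge
  set B : Rn n → EReal := fun y =>
    if ∀ γ, legendre f (ρ γ y) ≠ ⊤ then ((b y + ε * ‖y‖ : ℝ) : EReal) else ⊤
  have hBinv : IsInvFun ρ B := by
    intro γ y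
    have : (∀ γ', legendre f (ρ γ' (ρ γ y)) ≠ ⊤) ↔ ∀ γ', legendre f (ρ γ' y) ≠ ⊤ := by
      rw [← (Equiv.mulRight γ).forall_congr_right (q := fun γ' => legendre f (ρ γ' y) ≠ ⊤)]
      simp
    simp only [B, this, LinearIsometryEquiv.norm_map, b, orbitAvg_apply_map]
  have hB : ∀ y, ∀ r : ℝ, B y ≤ r → (∀ γ, legendre f (ρ γ y) ≠ ⊤) ∧ b y + ε * ‖y‖ ≤ r := by
    intro y r hr
    by_cases h : ∀ γ, legendre f (ρ γ y) ≠ ⊤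
    · simp only [B, if_pos h] at hr
      exact ⟨h, by exact_mod_cast hr⟩
    · simp [B, if_neg h] at hr
  have hB' : ∀ y, (∀ γ, legendre f (ρ γ y) ≠ ⊤) → B y = ((b y + ε * ‖y‖ : ℝ) : EReal) :=
    fun y h => if_pos h
  have hBf : ∀ x x₁, (∀ γ, f (ρ γ x₁) ≠ ⊤) → ‖x - x₁‖ ≤ ε → legendre B x ≤ a x₁ := by
    intro x x₁ h1 hxx
    refine legendre_le_of_forall fun y r hr => ?_
    obtain ⟨h2, h3⟩ := hB y r hr
    have h4 := hab x₁ y h1 h2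
    have h5 : inner ℝ y (x - x₁) ≤ ‖y‖ * ε :=
      (real_inner_le_norm _ _).trans (by gcongr)
    rw [inner_sub_right, real_inner_comm x₁ y] at h5
    linarith
  -- The second perturbation, on the side of `f`; the regularized function is the conjugate of `A`,
  -- and its own conjugate is at most `A`.
  set A : Rn n → EReal := fun x => legendre B x + ((ε * ‖x‖ : ℝ) : EReal)
  have hAinv : IsInvFun ρ A := by
    intro γ x
    simp only [A, hBinv.legendre γ x, LinearIsometryEquiv.norm_map]
  have hAle : ∀ x x₁, (∀ γ, f (ρ γ x₁) ≠ ⊤) → ‖x - x₁‖ ≤ ε →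
      A x ≤ ((a x₁ + ε * ‖x‖ : ℝ) : EReal) := by
    intro x x₁ h1 hxx
    rw [EReal.coe_add]
    exact add_le_add_left (hBf x x₁ h1 hxx) _
  have hgle : ∀ y y₁, (∀ γ, legendre f (ρ γ y₁) ≠ ⊤) → ‖y - y₁‖ ≤ ε →
      legendre A y ≤ ((b y₁ + ε * ‖y₁‖ : ℝ) : EReal) := by
    intro y y₁ h1 hyy
    refine legendre_le_of_forall fun x r hr => ?_
    have h2 : legendre B x ≤ ((r - ε * ‖x‖ : ℝ) : EReal) := by
      rw [EReal.coe_sub]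
      rw [← EReal.add_sub_cancel_right (a := legendre B x) (b := ε * ‖x‖)]
      exact EReal.sub_le_sub hr le_rfl
    have h3 := inner_le_add_of_legendre_le (hB' y₁ h1).le h2
    have h5 : inner ℝ x (y - y₁) ≤ ‖x‖ * ε :=
      (real_inner_le_norm _ _).trans (by gcongr)
    rw [inner_sub_right, real_inner_comm y₁ x] at h5
    linarith
  have hA₀ : ∃ x, A x < ⊤ := ⟨x₀, (hAle x₀ x₀ hx₀ (by simp [hε.le])).trans_lt (EReal.coe_lt_top _)⟩
  have hg : IsClosedConvex (legendre A) := isClosedConvex_legendre hA₀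
    ⟨y₀, (hgle y₀ y₀ hy₀ (by simp [hε.le])).trans_lt (EReal.coe_lt_top _)⟩
  have hball : ∀ z : Rn n, volume (Metric.closedBall z ε) ≠ 0 := fun z =>
    (Metric.measure_closedBall_pos volume z hε).ne'
  refine ⟨legendre A, hg, hAinv.legendre, ?_, ?_, ?_, ?_⟩
  · refine expInt_pos hg.measurable (hball y₀) fun y hy => ?_
    exact ((hgle y y₀ hy₀ (mem_closedBall_iff_norm.1 hy)).trans_lt (EReal.coe_lt_top _)).ne
  · refine expInt_pos hg.legendre.measurable (hball x₀) fun x hx => ?_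
    exact ((legendre_legendre_le A x).trans_lt
      ((hAle x x₀ hx₀ (mem_closedBall_iff_norm.1 hx)).trans_lt (EReal.coe_lt_top _))).ne
  · exact fun y h => hgle y y h (by simp [hε.le])
  · exact fun x h => (legendre_legendre_le A x).trans (hAle x x h (by simp [hε.le]))

theorem ae_forall_map {ν : Measure (Rn n)} (hν : ν ∈ P1inv ρ) {p : Rn n → Prop}
    (h : ∀ᵐ x ∂ν, p x) : ∀ᵐ x ∂ν, ∀ γ, p (ρ γ x) := by
  rw [ae_all_iff]
  intro γ
  refine ae_of_ae_map (ρ γ).continuous.aemeasurable ?_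
  rwa [hν.2 γ]

theorem eintegral_le_of_le_orbitAvg {ν : Measure (Rn n)} (hν : ν ∈ P1inv ρ) {f g : Rn n → EReal}
    {F : Rn n → ℝ} (hF : Integrable F ν) (hfF : f =ᵐ[ν] fun x => (F x : EReal)) {ε : ℝ}
    (hg : ∀ x, (∀ γ, f (ρ γ x) ≠ ⊤) →
      g x ≤ ((orbitAvg ρ (fun x => (f x).toReal) x + ε * ‖x‖ : ℝ) : EReal)) :
    eintegral ν g ≤ ((∫ x, F x ∂ν + ε * ∫ x, ‖x‖ ∂ν : ℝ) : EReal) := by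
  obtain ⟨h1, h2⟩ := integrable_orbitAvg hν hF
  have h3 : Integrable (fun x => ε * ‖x‖) ν := hν.1.2.const_mul ε
  have h4 : Integrable (fun x => orbitAvg ρ F x + ε * ‖x‖) ν := h1.add h3
  rw [← h2, ← integral_const_mul, ← integral_add h1 h3, ← eintegral_coe h4]
  refine eintegral_mono_ae ?_
  filter_upwards [ae_forall_map hν hfF] with x hx
  refine (hg x fun γ => by rw [hx γ]; exact EReal.coe_ne_top _).trans (le_of_eq ?_)
  congr 2
  exact orbitAvg_congr fun γ => by rw [hx γ, EReal.toReal_coe]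

/-- The inverse Santaló inequality implies the transport-entropy inequality. -/
theorem InverseSantaloOn.transportEntropyIneq {c : ℝ} (hc : 0 < c)
    (h : InverseSantaloOn n c (IsInvFun ρ)) {ν₁ ν₂ : Measure (Rn n)} (hν₁ : ν₁ ∈ P1inv ρ)
    (hν₂ : ν₂ ∈ P1inv ρ) : TransportEntropyIneq c (P1inv ρ) ν₁ ν₂ := by
  have := hν₁.1.1
  have := hν₂.1.1
  set K := infTransportEntropy (P1inv ρ) ν₁ + infTransportEntropy (P1inv ρ) ν₂
  -- With the constant on the left, the infimum on the right can be tested one f at a time.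
  have key : K + ((n * Real.log c : ℝ) : EReal) ≤ maxCorr ν₁ ν₂ := by
    refine le_iInf₂ fun f hf => ?_
    rcases hf.eintegral_eq_top_or hν₁.1 with h1 | ⟨F₁, hF₁, hfF₁, h1⟩
    · rw [h1, EReal.top_add_of_ne_bot (hf.legendre.eintegral_ne_bot hν₂.1)]
      exact le_top
    rcases hf.legendre.eintegral_eq_top_or hν₂.1 with h2 | ⟨F₂, hF₂, hfF₂, h2⟩
    · rw [h2, EReal.add_top_of_ne_bot (hf.eintegral_ne_bot hν₁.1)]
      exact le_top
    rw [h1, h2, ← EReal.coe_add]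
    have hstep : ∀ ε : ℝ, 0 < ε → K ≤ (((∫ x, F₁ x ∂ν₁ + ε * ∫ x, ‖x‖ ∂ν₁) +
        (∫ x, F₂ x ∂ν₂ + ε * ∫ x, ‖x‖ ∂ν₂) - n * Real.log c : ℝ) : EReal) := by
      intro ε hε
      have hx : ∃ x, ∀ γ, f (ρ γ x) ≠ ⊤ := by
        obtain ⟨x, hx⟩ := (ae_forall_map hν₁ hfF₁).exists
        exact ⟨x, fun γ => by rw [hx γ]; exact EReal.coe_ne_top _⟩
      have hy : ∃ y, ∀ γ, legendre f (ρ γ y) ≠ ⊤ := by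
        obtain ⟨x, hx⟩ := (ae_forall_map hν₂ hfF₂).exists
        exact ⟨x, fun γ => by rw [hx γ]; exact EReal.coe_ne_top _⟩
      obtain ⟨g, hg, hginv, hp1, hp2, hg2, hg1⟩ := exists_regularization hε hx hy hf.ne_bot
      exact infTransportEntropy_add_le hg hginv hc (eintegral_le_of_le_orbitAvg hν₁ hF₁ hfF₁ hg1)
        (eintegral_le_of_le_orbitAvg hν₂ hF₂ hfF₂ hg2) hp1 hp2 (h g hg hginv hp1 hp2)
    induction hKv : K with
    | bot => simp
    | top =>
      have := hstep 1 one_pos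
      simp only [hKv, top_le_iff] at this
      exact absurd this (EReal.coe_ne_top _)
    | coe κ =>
      rw [← EReal.coe_add, EReal.coe_le_coe_iff]
      set M : ℝ := ∫ x, ‖x‖ ∂ν₁ + ∫ x, ‖x‖ ∂ν₂
      have hM : 0 ≤ M := add_nonneg (integral_nonneg fun _ => norm_nonneg _)
        (integral_nonneg fun _ => norm_nonneg _)
      refine le_of_forall_pos_le_add fun δ hδ => ?_
      -- The regularization costs ε M, where `M` is the sum of the first moments; the 1 avoids
      -- division by zero.
      have h3 := hstep (δ / (M + 1)) (by positivity)
      rw [hKv, EReal.coe_le_coe_iff] at h3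
      have h4 : δ / (M + 1) * M ≤ δ := by
        rw [div_mul_eq_mul_div, div_le_iff₀ (by positivity)]
        nlinarith
      simp only [M] at h4 h3
      linarith
  unfold TransportEntropyIneq
  calc K = ((-(n * Real.log c) : ℝ) : EReal) + (K + ((n * Real.log c : ℝ) : EReal)) := by
        rw [add_comm K, ← add_assoc, ← EReal.coe_add]
        simp
    _ ≤ _ := by gcongr

end Regularization

/-! ### Coercivity and finiteness of the approximating integrals -/

section Coercivity

variable {n : ℕ}

theorem IsClosedConvex.convex_dom {f : Rn n → EReal} (hf : IsClosedConvex f) :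
    Convex ℝ {x | f x < ⊤} := by
  refine convex_iff_forall_pos.2 fun x hx y hy a b ha hb hab => ?_
  have hx' : f x < ⊤ := hx
  have hy' : f y < ⊤ := hy
  lift f x to ℝ using ⟨hx'.ne, hf.ne_bot x⟩ with s hs
  lift f y to ℝ using ⟨hy'.ne, hf.ne_bot y⟩ with t ht
  have := hf.convex x y a b ha hb hab
  rw [← hs, ← ht, ← EReal.coe_mul, ← EReal.coe_mul, ← EReal.coe_add] at this
  exact this.trans_lt (EReal.coe_lt_top _)

/-- A convex set with empty interior is contained in its frontier, which is Lebesgue-null. -/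
theorem IsClosedConvex.interior_dom_nonempty {f : Rn n → EReal} (hf : IsClosedConvex f)
    (h : 0 < expInt f) : (interior {x | f x < ⊤}).Nonempty := by
  by_contra hne
  rw [not_nonempty_iff_eq_empty] at hne
  have hnull : volume {x | f x < ⊤} = 0 := by
    refine measure_mono_null (fun x hx => ?_) (hf.convex_dom.addHaar_frontier volume)
    rw [frontier, hne, sdiff_empty]
    exact subset_closure hx
  refine h.ne' ?_
  have hm : Measurable fun x => EReal.exp (-f x) := hf.measurable.neg.ereal_exp
  unfold expInt
  rw [lintegral_eq_zero_iff hm]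
  refine measure_mono_null (fun x hx => ?_) hnull
  have hx' : EReal.exp (-f x) ≠ 0 := hx
  rw [ne_eq, EReal.exp_eq_zero_iff, EReal.neg_eq_bot_iff] at hx'
  exact lt_top_iff_ne_top.2 hx'

/-- An integrable function that is nondecreasing along a direction vanishes almost everywhere. -/
theorem lintegral_eq_zero_of_le_translate {q : Rn n → ℝ≥0∞} {v : Rn n}
    (hv : v ≠ 0) (hqv : ∀ y, q y ≤ q (y + v)) (hfin : ∫⁻ y, q y ≠ ∞) : ∫⁻ y, q y = 0 := by
  -- Index of the slab orthogonal to `v` containing y; translation by `v` moves slab k to slab k +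
  -- 1. Slab masses are therefore nondecreasing, so one positive mass makes the total infinite.
  set φ : Rn n → ℤ := fun y => ⌊(inner ℝ v y : ℝ) / ‖v‖ ^ 2⌋
  have hφ : Measurable φ := by
    refine Int.measurable_floor.comp (Measurable.div_const ?_ _)
    fun_prop
  have hφv : ∀ y, φ (y + v) = φ y + 1 := by
    intro y
    simp only [φ]
    rw [inner_add_right, real_inner_self_eq_norm_sq, add_div,
      div_self (pow_ne_zero 2 (norm_ne_zero_iff.2 hv)), Int.floor_add_one]
  set I : ℤ → ℝ≥0∞ := fun k => ∫⁻ y in φ ⁻¹' {k}, q y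
  have hmeas : ∀ k : ℤ, MeasurableSet (φ ⁻¹' {k}) := fun k => hφ (measurableSet_singleton k)
  have hstep : ∀ k, I k ≤ I (k + 1) := by
    intro k
    simp only [I]
    rw [← lintegral_indicator (hmeas _), ← lintegral_indicator (hmeas _),
      ← lintegral_add_right_eq_self ((φ ⁻¹' {k + 1}).indicator q) v]
    refine lintegral_mono fun y => ?_
    by_cases hy : φ y = k
    · rw [indicator_of_mem (show y ∈ φ ⁻¹' {k} from hy),
        indicator_of_mem (show y + v ∈ φ ⁻¹' {k + 1} by simp [hφv, hy])]
      exact hqv y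
    · rw [indicator_of_notMem (show y ∉ φ ⁻¹' {k} from hy)]
      exact zero_le
  have hsum : ∫⁻ y, q y = ∑' k, I k := by
    rw [← lintegral_iUnion hmeas
      fun i j hij => Disjoint.preimage _ (disjoint_singleton.2 hij),
      ← preimage_iUnion, iUnion_of_singleton, preimage_univ, setLIntegral_univ]
  have hI : ∀ k, I k = 0 := by
    intro k
    by_contra hk
    have hmono : ∀ j : ℕ, I k ≤ I (k + j) := by
      intro j
      induction j with
      | zero => simp
      | succ j ih =>
        refine ih.trans ((hstep _).trans (le_of_eq ?_))
        push_cast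
        rw [add_assoc]
    refine hfin ?_
    rw [hsum, ← top_le_iff, ← ENNReal.tsum_const_eq_top_of_ne_zero (α := ℕ) hk]
    refine (ENNReal.tsum_le_tsum hmono).trans ?_
    exact ENNReal.tsum_comp_le_tsum_of_injective
      (f := fun j : ℕ => k + (j : ℤ)) (fun a b hab => by simpa using hab) I
  rw [hsum]
  simp [hI]

/-- If `exp (-f*)` has a finite positive integral then `0` is interior to the domain of `f`. -/
theorem IsClosedConvex.zero_mem_interior_dom {f : Rn n → EReal} (hf : IsClosedConvex f)
    (h : 0 < expInt f) (h0 : 0 < expInt (InverseSantalo.legendre f))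
    (hfin : expInt (InverseSantalo.legendre f) ≠ ∞) : (0 : Rn n) ∈ interior {x | f x < ⊤} := by
  by_contra hnot
  have hne := hf.interior_dom_nonempty h
  -- Otherwise the domain lies in a half-space {F ≤ 0}, so f* is nonincreasing along the vector `v`
  -- representing `F`, and the integral of exp(-f*) is zero or infinite.
  obtain ⟨F, hF⟩ := geometric_hahn_banach_open_point hf.convex_dom.interior isOpen_interior hnot
  rw [map_zero] at hF
  have hF' : ∀ x, f x < ⊤ → F x ≤ 0 := by
    intro x hx
    have hcl : x ∈ closure (interior {x | f x < ⊤}) := by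
      rw [hf.convex_dom.closure_interior_eq_closure_of_nonempty_interior hne]
      exact subset_closure hx
    exact closure_minimal (fun a ha => (hF a ha).le)
      (isClosed_le F.continuous continuous_const) hcl
  set v := (InnerProductSpace.toDual ℝ (Rn n)).symm F
  have hFv : ∀ x, inner ℝ x v = F x := fun x => by
    rw [real_inner_comm, InnerProductSpace.toDual_symm_apply]
  have hv : v ≠ 0 := by
    intro hv0
    obtain ⟨a, ha⟩ := hne
    have := hF a ha
    rw [← hFv, hv0, inner_zero_right] at this
    exact lt_irrefl _ this
  have hle : ∀ y, InverseSantalo.legendre f (y + v) ≤ InverseSantalo.legendre f y := by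
    intro y
    refine iSup_le fun x => ?_
    by_cases hx : f x < ⊤
    · refine le_trans (EReal.sub_le_sub ?_ le_rfl) (inner_sub_le_legendre f x y)
      rw [EReal.coe_le_coe_iff, inner_add_right, hFv]
      linarith [hF' x hx]
    · rw [not_lt_top_iff] at hx
      simp [hx]
  refine h0.ne' (lintegral_eq_zero_of_le_translate hv (fun y => ?_) hfin)
  exact EReal.exp_monotone (EReal.neg_le_neg_iff.2 (hle y))

theorem integrable_exp_neg_mul_norm {δ : ℝ} (hδ : 0 < δ) :
    Integrable (fun y : Rn n => Real.exp (-(δ * ‖y‖))) volume := by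
  set k : ℕ := n + 1
  have h1 : Integrable (fun y : Rn n => Real.exp δ * k.factorial / δ ^ k * (1 + ‖y‖) ^ (-(k : ℝ)))
      volume := (integrable_one_add_norm (by simp [k])).const_mul _
  refine h1.mono' (by fun_prop) (ae_of_all _ fun y => ?_)
  have hy : 0 < 1 + ‖y‖ := by positivity
  have h2 := Real.pow_div_factorial_le_exp (δ * (1 + ‖y‖)) (by positivity) k
  rw [Real.norm_of_nonneg (Real.exp_pos _).le, Real.rpow_neg hy.le, Real.rpow_natCast]
  have h3 : Real.exp (-(δ * ‖y‖)) = Real.exp δ * (Real.exp (δ * (1 + ‖y‖)))⁻¹ := by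
    rw [← Real.exp_neg, ← Real.exp_add]
    congr 1
    ring
  rw [h3, mul_div_assoc, mul_assoc]
  refine mul_le_mul_of_nonneg_left ?_ (Real.exp_pos _).le
  rw [inv_le_comm₀ (Real.exp_pos _) (by positivity)]
  refine le_trans (le_of_eq ?_) h2
  rw [mul_pow]
  field_simp

/-- Every ball about the origin contains a finite set whose support function is coercive. -/
theorem exists_finset_inner_ge {δ : ℝ} (hδ : 0 < δ) :
    ∃ X : Finset (Rn n), X.Nonempty ∧ (∀ x ∈ X, ‖x‖ < δ) ∧
      ∀ y : Rn n, ∃ x ∈ X, δ / 4 * ‖y‖ ≤ inner ℝ x y := by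
  classical
  -- The point of a δ/4-net nearest to (δ/2) y/‖y‖ loses at most δ/4 of the factor δ/2; for y = 0
  -- the convention 0⁻¹ = 0 gives the origin.
  obtain ⟨t, ht, htf, hcov⟩ := (isCompact_closedBall (0 : Rn n) (δ / 2)).finite_cover_balls
    (e := δ / 4) (by positivity)
  have hkey : ∀ y : Rn n, ∃ x ∈ t, δ / 4 * ‖y‖ ≤ inner ℝ x y := by
    intro y
    set z : Rn n := (δ / 2 * ‖y‖⁻¹) • y
    have hz : z ∈ Metric.closedBall (0 : Rn n) (δ / 2) := by
      rw [mem_closedBall_zero_iff, norm_smul, Real.norm_of_nonneg (by positivity), mul_assoc]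
      have : ‖y‖⁻¹ * ‖y‖ ≤ 1 := inv_mul_le_one
      nlinarith
    obtain ⟨x, hx, hxz⟩ := mem_iUnion₂.1 (hcov hz)
    refine ⟨x, hx, ?_⟩
    have h1 : inner ℝ z y = δ / 2 * ‖y‖ := by
      simp only [z]
      rw [inner_smul_left, real_inner_self_eq_norm_sq]
      by_cases hy : ‖y‖ = 0
      · simp [hy]
      · simp only [conj_trivial]
        field_simp
    have h2 : inner ℝ (z - x) y ≤ δ / 4 * ‖y‖ :=
      (real_inner_le_norm _ _).trans (by
        gcongr
        exact (mem_ball_iff_norm.1 hxz).le)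
    rw [inner_sub_left, h1] at h2
    linarith
  refine ⟨htf.toFinset, ?_, fun x hx => ?_, fun y => ?_⟩
  · obtain ⟨x, hx, -⟩ := hkey 0
    exact ⟨x, htf.mem_toFinset.2 hx⟩
  · have := ht (htf.mem_toFinset.1 hx)
    rw [mem_closedBall_zero_iff] at this
    linarith
  · obtain ⟨x, hx, h⟩ := hkey y
    exact ⟨x, htf.mem_toFinset.2 hx, h⟩

theorem maxAffineInt_ne_top {X : Finset (Rn n)} (hX : X.Nonempty) (u : Rn n → ℝ) {δ : ℝ}
    (hδ : 0 < δ) (h : ∀ y : Rn n, ∃ x ∈ X, δ * ‖y‖ ≤ inner ℝ x y) : maxAffineInt hX u ≠ ∞ := by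
  set U : ℝ := X.sup' hX u
  have h1 : Integrable (fun y : Rn n => Real.exp U * Real.exp (-(δ * ‖y‖))) volume :=
    (integrable_exp_neg_mul_norm hδ).const_mul _
  refine ne_top_of_le_ne_top h1.lintegral_lt_top.ne (lintegral_mono fun y => ?_)
  refine ENNReal.ofReal_le_ofReal ?_
  rw [← Real.exp_add]
  refine Real.exp_le_exp.2 ?_
  obtain ⟨x, hx, hxy⟩ := h y
  have h2 := le_maxAffine hX u hx y
  have h3 : u x ≤ U := Finset.le_sup' u hx
  linarith

end Coercivity

/-! ### Finitely supported measures -/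

section DiscreteMeasure

variable {n : ℕ}

/-- The measure `∑ w(x) δ_x`, where `x` runs through a finite set. -/
noncomputable def discreteMeasure (X : Finset (Rn n)) (w : Rn n → ℝ) : Measure (Rn n) :=
  ∑ x ∈ X, ENNReal.ofReal (w x) • Measure.dirac x

variable {X : Finset (Rn n)} {w : Rn n → ℝ}

theorem discreteMeasure_apply {s : Set (Rn n)} (hs : MeasurableSet s) :
    discreteMeasure X w s = ∑ x ∈ X, ENNReal.ofReal (w x) * s.indicator 1 x := by
  simp [discreteMeasure, Measure.finsetSum_apply, Measure.dirac_apply' _ hs]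

theorem ae_discreteMeasure_iff {p : Rn n → Prop} (hw : ∀ x, 0 ≤ w x) :
    (∀ᵐ x ∂discreteMeasure X w, p x) ↔ ∀ x ∈ X, w x ≠ 0 → p x := by
  rw [ae_iff, discreteMeasure, Measure.finsetSum_apply, Finset.sum_eq_zero_iff]
  refine forall₂_congr fun x _ => ?_
  rw [Measure.smul_apply, smul_eq_mul, mul_eq_zero, Measure.dirac_apply, ENNReal.ofReal_eq_zero,
    ← not_imp_comm]
  by_cases hp : p x
  · simp [hp]
  · simp [hp, (hw x).ge_iff_eq']

theorem integrable_discreteMeasure (F : Rn n → ℝ) : Integrable F (discreteMeasure X w) := by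
  refine integrable_finsetSum_measure.2 fun x _ => ?_
  exact (integrable_dirac (by simp)).smul_measure ENNReal.ofReal_ne_top

theorem integral_discreteMeasure (hw : ∀ x, 0 ≤ w x) (F : Rn n → ℝ) :
    ∫ x, F x ∂discreteMeasure X w = ∑ x ∈ X, w x * F x := by
  unfold discreteMeasure
  rw [integral_finsetSum_measure fun x _ =>
    (integrable_dirac (by simp)).smul_measure ENNReal.ofReal_ne_top]
  refine Finset.sum_congr rfl fun x _ => ?_
  rw [integral_smul_measure, integral_dirac, ENNReal.toReal_ofReal (hw x), smul_eq_mul]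

theorem discreteMeasure_mem_P1 (hw : ∀ x, 0 ≤ w x) (hw1 : ∑ x ∈ X, w x = 1) :
    discreteMeasure X w ∈ P1 n := by
  refine ⟨⟨?_⟩, integrable_discreteMeasure _⟩
  rw [discreteMeasure_apply MeasurableSet.univ]
  simp only [indicator_univ, Pi.one_apply, mul_one]
  rw [← ENNReal.ofReal_sum_of_nonneg fun x _ => hw x, hw1, ENNReal.ofReal_one]

theorem isCompact_support_discreteMeasure : IsCompact (discreteMeasure X w).support := by
  refine X.finite_toSet.isCompact.of_isClosed_subset Measure.isClosed_support
    (Measure.support_subset_of_isClosed X.finite_toSet.isClosed ?_)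
  rw [mem_ae_iff, discreteMeasure_apply X.finite_toSet.measurableSet.compl]
  exact Finset.sum_eq_zero fun x hx => by simp [hx]

theorem map_discreteMeasure (e : Rn n ≃ₗᵢ[ℝ] Rn n) (hX : ∀ x, e x ∈ X ↔ x ∈ X)
    (hw : ∀ x, w (e x) = w x) : (discreteMeasure X w).map e = discreteMeasure X w := by
  have he : Measurable e := e.continuous.measurable
  ext s hs
  rw [Measure.map_apply he hs, discreteMeasure_apply hs, discreteMeasure_apply (he hs)]
  refine Finset.sum_equiv e.toEquiv (fun x => (hX x).symm) fun x _ => ?_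
  show _ = ENNReal.ofReal (w (e x)) * s.indicator 1 (e x)
  rw [hw]
  by_cases hx : e x ∈ s
  · rw [indicator_of_mem hx, indicator_of_mem (show x ∈ e ⁻¹' s from hx)]; rfl
  · rw [indicator_of_notMem hx, indicator_of_notMem (show x ∉ e ⁻¹' s from hx)]

end DiscreteMeasure

/-! ### Lower bounds for the transport cost -/

section MaxCorr

variable {n : ℕ}

/-- Integrating x · y ≥ -‖x‖‖y‖ in the Fenchel–Young inequality, first in x and then in y, gives the
lower bound -∫‖x‖ dν ∫‖y‖ dη. It is needed because ⊥ + ⊤ = ⊥ in `EReal`, which would spoil the case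
of infinite entropy. -/
theorem maxCorr_ne_bot {ν η : Measure (Rn n)} (hν : ν ∈ P1 n) (hη : η ∈ P1 n) :
    maxCorr ν η ≠ ⊥ := by
  have := hν.1
  have := hη.1
  set M : ℝ := ∫ x, ‖x‖ ∂ν
  have hb : ((-(∫ y, ‖y‖ ∂η) * M : ℝ) : EReal) ≤ maxCorr ν η := by
    refine le_iInf₂ fun φ hφ => ?_
    rcases hφ.eintegral_eq_top_or hν with h1 | ⟨F, hF, hφF, h1⟩
    · rw [h1, EReal.top_add_of_ne_bot (hφ.legendre.eintegral_ne_bot hη)]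
      exact le_top
    set I := ∫ x, F x ∂ν
    have hl : ∀ y, ((-‖y‖ * M - I : ℝ) : EReal) ≤ legendre φ y := by
      intro y
      by_cases hy : legendre φ y = ⊤
      · rw [hy]; exact le_top
      lift legendre φ y to ℝ using ⟨hy, legendre_ne_bot hφ.exists_lt_top y⟩ with s hs
      rw [EReal.coe_le_coe_iff]
      have hint : Integrable (fun x => -‖y‖ * ‖x‖ - F x) ν := (hν.2.const_mul _).sub hF
      have h2 : ∫ x, (-‖y‖ * ‖x‖ - F x) ∂ν ≤ ∫ _, s ∂ν := by
        refine integral_mono_ae hint (integrable_const s) ?_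
        filter_upwards [hφF] with x hx
        have h3 := inner_le_add_of_legendre_le hx.le hs.ge
        have h4 := (abs_le.1 (abs_real_inner_le_norm x y)).1
        linarith
      rw [integral_sub (hν.2.const_mul _) hF, integral_const_mul] at h2
      simpa using h2
    have h5 : Integrable (fun y => -‖y‖ * M - I) η :=
      (hη.2.neg.mul_const M).sub (integrable_const I)
    have h6 := le_eintegral h5 (ae_of_all η hl)
    have h7 : ∫ y, (-‖y‖ * M - I) ∂η = -(∫ y, ‖y‖ ∂η) * M - I := by
      have h8 : Integrable (fun y => -‖y‖ * M) η := hη.2.neg.mul_const M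
      rw [integral_sub h8 (integrable_const I), integral_mul_const, integral_neg]
      simp
    rw [h7] at h6
    rw [h1]
    refine le_trans (le_of_eq ?_) (add_le_add_right h6 (I : EReal))
    rw [← EReal.coe_add]
    congr 1
    ring
  exact ((EReal.bot_lt_coe _).trans_le hb).ne'

theorem le_maxCorr_add_entropyLeb {ν η : Measure (Rn n)} (hν : ν ∈ P1 n) (hη : η ∈ P1 n) {c : ℝ}
    (h : ∀ φ, IsClosedConvex φ →
      (c : EReal) ≤ eintegral ν φ + eintegral η (legendre φ) + entropyLeb η) :
    (c : EReal) ≤ maxCorr ν η + entropyLeb η := by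
  by_cases hH : entropyLeb η = ⊤
  · rw [hH, EReal.add_top_of_ne_bot (maxCorr_ne_bot hν hη)]
    exact le_top
  lift entropyLeb η to ℝ using ⟨hH, entropyLeb_ne_bot hη⟩ with H
  have h1 : ((c - H : ℝ) : EReal) ≤ maxCorr ν η := by
    refine le_iInf₂ fun φ hφ => ?_
    rw [EReal.coe_sub]
    exact EReal.sub_le_of_le_add (h φ hφ)
  refine le_trans (le_of_eq ?_) (add_le_add_left h1 (H : EReal))
  rw [← EReal.coe_add, sub_add_cancel]

end MaxCorr

/-! ### Discrete moment measures are almost extremal -/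

section MomentMeasure

variable {n : ℕ} {X : Finset (Rn n)} (hX : X.Nonempty)

/-- Lower bound for `∫ φ dν - log ∫ exp (-φ*)` when `ν` is the discrete moment measure of
a maximum of affine functions. -/
theorem expInt_legendre_le_of_weights {w u : Rn n → ℝ} (hw : ∀ x, 0 ≤ w x)
    {a : ℝ} (ha : 0 < a)
    (hle : ∀ v : Rn n → ℝ, maxAffineInt hX v ≤
      ENNReal.ofReal (a * Real.exp (∑ x ∈ X, w x * (v x - u x))))
    {φ : Rn n → EReal} (hφ : IsClosedConvex φ) {F : Rn n → ℝ}
    (hF : ∀ x ∈ X, w x ≠ 0 → φ x = F x) :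
    expInt (legendre φ) ≤
      ENNReal.ofReal (a * Real.exp (∑ x ∈ X, w x * F x - ∑ x ∈ X, w x * u x)) := by
  -- The tangent inequality needs real values, but φ may be +∞ at points of zero weight; truncations
  -- avoid this, with a bound independent of `K`.
  set v : ℕ → Rn n → ℝ := fun K x => (min (φ x) (K : ℝ)).toReal
  have hvφ : ∀ K x, (v K x : EReal) = min (φ x) (K : ℝ) := fun K x =>
    EReal.coe_toReal ((min_le_right _ _).trans_lt (EReal.coe_lt_top _)).ne
      (lt_min (bot_lt_iff_ne_bot.2 (hφ.ne_bot x)) (EReal.bot_lt_coe _)).ne'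
  have hvmono : ∀ x, Monotone fun K => v K x := by
    intro x J K hJK
    rw [← EReal.coe_le_coe_iff, hvφ, hvφ]
    exact min_le_min le_rfl (by exact_mod_cast hJK)
  have hbound : ∀ K, maxAffineInt hX (v K) ≤
      ENNReal.ofReal (a * Real.exp (∑ x ∈ X, w x * F x - ∑ x ∈ X, w x * u x)) := by
    intro K
    refine (hle (v K)).trans (ENNReal.ofReal_le_ofReal ?_)
    refine mul_le_mul_of_nonneg_left (Real.exp_le_exp.2 ?_) ha.le
    rw [← Finset.sum_sub_distrib]
    refine Finset.sum_le_sum fun x hx => ?_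
    rw [← mul_sub]
    by_cases hwx : w x = 0
    · simp [hwx]
    refine mul_le_mul_of_nonneg_left ?_ (hw x)
    have : v K x ≤ F x := by
      rw [← EReal.coe_le_coe_iff, hvφ, hF x hx hwx]
      exact min_le_left _ _
    linarith
  have hpt : ∀ y, EReal.exp (-legendre φ y) ≤
      ⨆ K : ℕ, ENNReal.ofReal (Real.exp (-maxAffine hX (v K) y)) := by
    intro y
    by_cases hy : legendre φ y = ⊤
    · simp [hy]
    have hyb := legendre_ne_bot hφ.exists_lt_top y
    lift legendre φ y to ℝ using ⟨hy, hyb⟩ with s hs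
    -- This `K` leaves finite values of φ on `X` untouched and is large enough that the points with
    -- φ = ⊤ do not push the maximum above φ*(y).
    obtain ⟨K, hK⟩ := exists_nat_ge (X.sup' hX fun x => max (φ x).toReal (inner ℝ x y - s))
    have hK' : ∀ x ∈ X, max (φ x).toReal (inner ℝ x y - s) ≤ K := fun x hx =>
      (Finset.le_sup' (fun x => max (φ x).toReal (inner ℝ x y - s)) hx).trans hK
    refine le_trans ?_ (le_iSup _ K)
    rw [← EReal.coe_neg, EReal.exp_coe]
    refine ENNReal.ofReal_le_ofReal (Real.exp_le_exp.2 (neg_le_neg ?_))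
    refine maxAffine_le hX _ fun x hx => ?_
    by_cases hxt : φ x = ⊤
    · have : v K x = K := by
        rw [← EReal.coe_eq_coe_iff, hvφ, hxt, min_eq_right le_top]
      rw [this]
      have := (le_max_right _ _).trans (hK' x hx)
      linarith
    · have h1 : φ x = ((φ x).toReal : EReal) := (EReal.coe_toReal hxt (hφ.ne_bot x)).symm
      have h2 : v K x = (φ x).toReal := by
        rw [← EReal.coe_eq_coe_iff, hvφ, ← h1, min_eq_left]
        rw [h1]
        exact_mod_cast (le_max_left _ _).trans (hK' x hx)
      rw [h2]
      have := inner_le_add_of_legendre_le h1.le hs.ge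
      linarith
  calc expInt (legendre φ)
      ≤ ∫⁻ y, ⨆ K : ℕ, ENNReal.ofReal (Real.exp (-maxAffine hX (v K) y)) :=
        lintegral_mono hpt
    _ = ⨆ K : ℕ, maxAffineInt hX (v K) := by
      refine lintegral_iSup (fun K => measurable_exp_neg_maxAffine hX (v K)) ?_
      intro J K hJK y
      refine ENNReal.ofReal_le_ofReal (Real.exp_le_exp.2 (neg_le_neg ?_))
      refine maxAffine_le hX _ fun x hx => ?_
      have := le_maxAffine hX (v J) hx y
      have := hvmono x hJK
      simp only at this
      linarith
    _ ≤ _ := iSup_le hbound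

/-- The tangent inequality bounds the integral of e^{-φ*} and the Gibbs principle turns this into a
bound on ∫ φ* dη + H(η | Leb), in which ∫ φ dν cancels. -/
theorem le_infTransportEntropy_of_weights {w u : Rn n → ℝ} (hw : ∀ x, 0 ≤ w x)
    (hw1 : ∑ x ∈ X, w x = 1) {a : ℝ} (ha : 0 < a)
    (hle : ∀ v : Rn n → ℝ, maxAffineInt hX v ≤
      ENNReal.ofReal (a * Real.exp (∑ x ∈ X, w x * (v x - u x))))
    {M : Set (Measure (Rn n))} (hM : M ⊆ P1 n) :
    ((∑ x ∈ X, w x * u x - Real.log a : ℝ) : EReal) ≤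
      infTransportEntropy M (discreteMeasure X w) := by
  have hν := discreteMeasure_mem_P1 hw hw1
  refine le_iInf₂ fun η hη => le_maxCorr_add_entropyLeb hν (hM hη) fun φ hφ => ?_
  rcases hφ.eintegral_eq_top_or hν with h1 | ⟨F, hF, hφF, h1⟩
  · rw [h1, EReal.top_add_of_ne_bot (hφ.legendre.eintegral_ne_bot (hM hη)),
      EReal.top_add_of_ne_bot (entropyLeb_ne_bot (hM hη))]
    exact le_top
  have h2 := expInt_legendre_le_of_weights hX hw ha hle hφ
    ((ae_discreteMeasure_iff hw).1 hφF)
  have h3 := neg_log_le_eintegral_add_entropyLeb (hM hη) hφ.legendre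
    (mul_pos ha (Real.exp_pos _)) h2
  rw [Real.log_mul ha.ne' (Real.exp_pos _).ne', Real.log_exp] at h3
  rw [h1, integral_discreteMeasure hw, add_assoc]
  refine le_trans (le_of_eq ?_) (add_le_add_right h3 _)
  rw [← EReal.coe_add]
  congr 1
  ring

end MomentMeasure

/-! ### Approximating the conjugate by finite maxima -/

section Approximation

variable {n : ℕ}

/-- Countably many affine functions suffice to define the Legendre transform. -/
theorem exists_seq_lt_of_lt_legendre {f : Rn n → EReal} (hb : ∀ x, f x ≠ ⊥) (ht : ∃ x, f x < ⊤) :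
    ∃ d : ℕ → Rn n, (∀ k, f (d k) < ⊤) ∧ ∀ y, ∀ t : ℝ, (t : EReal) < legendre f y →
      ∃ k, t < inner ℝ (d k) y - (f (d k)).toReal := by
  -- A dense sequence in the graph, not merely in the domain, approximates the values of f as well,
  -- though f may be discontinuous.
  set T : Set (Rn n × ℝ) := {p | f p.1 = (p.2 : EReal)}
  obtain ⟨x₀, hx₀⟩ := ht
  have hT : Nonempty T := ⟨⟨(x₀, (f x₀).toReal), (EReal.coe_toReal hx₀.ne (hb x₀)).symm⟩⟩
  refine ⟨fun k => (TopologicalSpace.denseSeq T k).1.1, fun k => ?_, fun y t hty => ?_⟩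
  · rw [(TopologicalSpace.denseSeq T k).2]
    exact EReal.coe_lt_top _
  · obtain ⟨x, hx⟩ := lt_iSup_iff.1 hty
    have hxt : f x ≠ ⊤ := fun h => by simp [h] at hx
    lift f x to ℝ using ⟨hxt, hb x⟩ with r hr
    have hopen : IsOpen {p : T | t < inner ℝ p.1.1 y - p.1.2} :=
      isOpen_lt continuous_const (by fun_prop)
    obtain ⟨k, hk⟩ := (TopologicalSpace.denseRange_denseSeq T).exists_mem_open hopen
      ⟨⟨(x, r), hr.symm⟩, by exact_mod_cast hx⟩
    refine ⟨k, ?_⟩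
    rw [(TopologicalSpace.denseSeq T k).2, EReal.toReal_coe]
    exact hk

/-- Decreasing monotone convergence, which is why the first integral must be finite. -/
theorem iInf_maxAffineInt_le {f : Rn n → EReal} {d : ℕ → Rn n}
    (hd : ∀ y, ∀ t : ℝ, (t : EReal) < legendre f y → ∃ k, t < inner ℝ (d k) y - (f (d k)).toReal)
    {X : ℕ → Finset (Rn n)} (hX : ∀ k, (X k).Nonempty) (hXmono : Monotone X)
    (hdX : ∀ k, d k ∈ X (k + 1))
    (hfin : maxAffineInt (hX 0) (fun x => (f x).toReal) ≠ ∞) :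
    ⨅ k, maxAffineInt (hX k) (fun x => (f x).toReal) ≤ expInt (legendre f) := by
  set u : Rn n → ℝ := fun x => (f x).toReal
  have hanti : Antitone fun (k : ℕ) y => ENNReal.ofReal (Real.exp (-maxAffine (hX k) u y)) := by
    intro j k hjk y
    refine ENNReal.ofReal_le_ofReal (Real.exp_le_exp.2 (neg_le_neg ?_))
    exact maxAffine_le _ _ fun x hx => le_maxAffine _ _ (hXmono hjk hx) y
  unfold maxAffineInt at hfin ⊢
  rw [← lintegral_iInf (fun k => measurable_exp_neg_maxAffine (hX k) u) hanti hfin]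
  refine lintegral_mono fun y => ?_
  by_contra! hlt
  set L := ⨅ k, ENNReal.ofReal (Real.exp (-maxAffine (hX k) u y))
  have h1 : -legendre f y < ENNReal.log L := by
    rw [← EReal.log_exp (-legendre f y)]
    exact ENNReal.log_lt_log hlt
  have h2 : -ENNReal.log L < legendre f y := EReal.neg_lt_comm.1 h1
  obtain ⟨t, ht1, ht2⟩ := EReal.lt_iff_exists_real_btwn.1 h2
  obtain ⟨k, hk⟩ := hd y t ht2
  have h3 : L ≤ ENNReal.ofReal (Real.exp (-t)) := by
    refine (iInf_le _ (k + 1)).trans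
      (ENNReal.ofReal_le_ofReal (Real.exp_le_exp.2 (neg_le_neg ?_)))
    exact hk.le.trans (le_maxAffine (hX (k + 1)) u (hdX k) y)
  have h4 := ENNReal.log_le_log h3
  rw [ENNReal.log_ofReal_of_pos (Real.exp_pos _), Real.log_exp, EReal.coe_neg] at h4
  exact absurd (EReal.neg_le_neg_iff.2 h4) (by rw [neg_neg]; exact not_le.2 ht1)

end Approximation

/-! ### From transport-entropy to the inverse Santaló inequality -/

section Converse

variable {n : ℕ} {Γ : Type*} [Group Γ] {ρ : Γ →* (Rn n ≃ₗᵢ[ℝ] Rn n)}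

/-- A coercive finite set near the origin makes the first integral finite; points of the
approximating sequence are then added, and everything is saturated under the finite group. -/
theorem exists_invariant_finset [Fintype Γ] {f : Rn n → EReal} (hf : IsClosedConvex f)
    (hinv : IsInvFun ρ f) (h : 0 < expInt f) (h0 : 0 < expInt (legendre f)) {a : ℝ≥0∞}
    (hfa : expInt (legendre f) < a) :
    ∃ (X : Finset (Rn n)) (hX : X.Nonempty), (∀ x ∈ X, f x < ⊤) ∧
      (∀ γ x, ρ γ x ∈ X ↔ x ∈ X) ∧ maxAffineInt hX (fun x => (f x).toReal) < a := by
  classical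
  have hint := hf.zero_mem_interior_dom h h0 (ne_top_of_lt hfa)
  obtain ⟨δ, hδ, hball⟩ := Metric.isOpen_iff.1 isOpen_interior 0 hint
  obtain ⟨X₀, hX₀, hX₀δ, hX₀y⟩ := exists_finset_inner_ge (n := n) hδ
  obtain ⟨d, hd1, hd2⟩ := exists_seq_lt_of_lt_legendre hf.ne_bot hf.exists_lt_top
  set P : ℕ → Finset (Rn n) := fun k => X₀ ∪ (Finset.range k).image d
  have hPdom : ∀ k, ∀ x ∈ P k, f x < ⊤ := by
    intro k x hx
    rcases Finset.mem_union.1 hx with hx | hx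
    · have : x ∈ {x | f x < ⊤} := interior_subset (hball (mem_ball_zero_iff.2 (hX₀δ x hx)))
      exact this
    · obtain ⟨j, -, rfl⟩ := Finset.mem_image.1 hx
      exact hd1 j
  set X : ℕ → Finset (Rn n) := fun k => Finset.univ.biUnion fun γ => (P k).image (ρ γ)
  have hmem : ∀ k x, x ∈ X k ↔ ∃ γ, ∃ z ∈ P k, ρ γ z = x := by simp [X]
  have hPX : ∀ k, P k ⊆ X k := fun k x hx => (hmem k x).2 ⟨1, x, hx, by simp⟩
  have hXne : ∀ k, (X k).Nonempty := fun k =>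
    hX₀.mono (Finset.subset_union_left.trans (hPX k))
  have hXdom : ∀ k, ∀ x ∈ X k, f x < ⊤ := by
    intro k x hx
    obtain ⟨γ, z, hz, rfl⟩ := (hmem k x).1 hx
    rw [hinv γ z]
    exact hPdom k z hz
  have hXinv1 : ∀ k γ x, x ∈ X k → ρ γ x ∈ X k := by
    intro k γ x hx
    obtain ⟨γ', z, hz, rfl⟩ := (hmem k x).1 hx
    exact (hmem k _).2 ⟨γ * γ', z, hz, by simp⟩
  have hXinv : ∀ k γ x, ρ γ x ∈ X k ↔ x ∈ X k := by
    refine fun k γ x => ⟨fun hx => ?_, hXinv1 k γ x⟩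
    have := hXinv1 k γ⁻¹ _ hx
    simpa using this
  have hXmono : Monotone X := by
    intro j k hjk
    refine Finset.biUnion_mono fun γ _ => Finset.image_subset_image ?_
    exact Finset.union_subset_union_right
      (Finset.image_subset_image (Finset.range_subset_range.2 hjk))
  have hfin : maxAffineInt (hXne 0) (fun x => (f x).toReal) ≠ ∞ :=
    maxAffineInt_ne_top _ _ (by positivity : 0 < δ / 4) fun y => by
      obtain ⟨x, hx, hxy⟩ := hX₀y y
      exact ⟨x, hPX 0 (Finset.mem_union_left _ hx), hxy⟩
  have hle := iInf_maxAffineInt_le hd2 hXne hXmono (fun k => hPX _ (Finset.mem_union_right _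
    (Finset.mem_image_of_mem _ (Finset.self_mem_range_succ k)))) hfin
  obtain ⟨k, hk⟩ := iInf_lt_iff.1 (hle.trans_lt hfa)
  exact ⟨X k, hXne k, hXdom k, hXinv k, hk⟩

theorem exists_compactSupport_le_infTransportEntropy [Fintype Γ] {f : Rn n → EReal}
    (hf : IsClosedConvex f) (hinv : IsInvFun ρ f) (h : 0 < expInt f)
    (h0 : 0 < expInt (legendre f)) {a : ℝ} (hfa : expInt (legendre f) < ENNReal.ofReal a) :
    ∃ ν ∈ P1inv ρ, IsCompact ν.support ∧ ∃ r : ℝ, eintegral ν f = r ∧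
      ((r - Real.log a : ℝ) : EReal) ≤ infTransportEntropy (P1inv ρ) ν := by
  have ha : 0 < a := ENNReal.ofReal_pos.1 (h0.trans hfa)
  obtain ⟨X, hX, hdom, hXinv, hXa⟩ :=
    exists_invariant_finset hf hinv h h0 hfa
  obtain ⟨w, hw, hw1, hle, hwinv⟩ := exists_weights hX _ (ne_top_of_lt hXa)
  have hν := discreteMeasure_mem_P1 hw hw1
  refine ⟨discreteMeasure X w, ⟨hν, fun γ => ?_⟩, isCompact_support_discreteMeasure,
    ∑ x ∈ X, w x * (f x).toReal, ?_, ?_⟩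
  · exact map_discreteMeasure _ (hXinv γ)
      (hwinv (ρ γ) (hXinv γ) fun x _ => by simp only [hinv γ x])
  · have hfe : f =ᵐ[discreteMeasure X w] fun x => ((f x).toReal : EReal) :=
      (ae_discreteMeasure_iff hw).2 fun x hx _ =>
        (EReal.coe_toReal (hdom x hx).ne (hf.ne_bot x)).symm
    rw [eintegral_congr_ae hfe, eintegral_coe (integrable_discreteMeasure _),
      integral_discreteMeasure hw]
  · refine le_infTransportEntropy_of_weights hX hw hw1 ha (fun v => (hle v).trans ?_)
      (fun ν hν => hν.1)
    rw [ENNReal.ofReal_mul ha.le]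
    gcongr

/-- The transport-entropy inequality for compactly supported measures implies the inverse Santaló
inequality. -/
theorem inverseSantaloOn_of_transportEntropyIneq [Fintype Γ] {c : ℝ} (hc : 0 < c)
    (h : ∀ ν₁ ∈ P1inv ρ, ∀ ν₂ ∈ P1inv ρ, IsCompact ν₁.support → IsCompact ν₂.support →
      TransportEntropyIneq c (P1inv ρ) ν₁ ν₂) :
    InverseSantaloOn n c (IsInvFun ρ) := by
  intro f hf hinv h1 h2
  by_cases hp : expInt f = ∞
  · rw [hp, ENNReal.top_mul h2.ne']
    exact le_top
  by_cases hq : expInt (legendre f) = ∞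
  · rw [hq, ENNReal.mul_top h1.ne']
    exact le_top
  have key : ∀ a b : ℝ, expInt f < ENNReal.ofReal a → expInt (legendre f) < ENNReal.ofReal b →
      c ^ n ≤ a * b := by
    intro a b ha hb
    have ha0 : 0 < a := ENNReal.ofReal_pos.1 (h1.trans ha)
    have hb0 : 0 < b := ENNReal.ofReal_pos.1 (h2.trans hb)
    obtain ⟨ν₁, hν₁, hc₁, r₁, hr₁, hk₁⟩ :=
      exists_compactSupport_le_infTransportEntropy hf hinv h1 h2 hb
    obtain ⟨ν₂, hν₂, hc₂, r₂, hr₂, hk₂⟩ :=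
      -- The same construction for f*, whose conjugate is f by Fenchel–Moreau.
      exists_compactSupport_le_infTransportEntropy hf.legendre hinv.legendre h2
        (by rwa [hf.legendre_legendre]) (a := a) (by rwa [hf.legendre_legendre])
    have hT : maxCorr ν₁ ν₂ ≤ ((r₁ + r₂ : ℝ) : EReal) := by
      refine (iInf₂_le f hf).trans (le_of_eq ?_)
      rw [hr₁, hr₂, EReal.coe_add]
    have h3 := (add_le_add hk₁ hk₂).trans ((h ν₁ hν₁ ν₂ hν₂ hc₁ hc₂).trans
      (add_le_add_right hT _))
    rw [← EReal.coe_add, ← EReal.coe_add, EReal.coe_le_coe_iff] at h3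
    rw [← Real.log_le_log_iff (by positivity) (by positivity), Real.log_pow,
      Real.log_mul ha0.ne' hb0.ne']
    linarith
  lift expInt f to NNReal using hp with p
  lift expInt (legendre f) to NNReal using hq with q
  have hlt : ∀ (p : NNReal) (ε : ℝ), 0 < ε → (p : ℝ≥0∞) < ENNReal.ofReal (p + ε) := by
    intro p ε hε
    rw [ENNReal.lt_ofReal_iff_toReal_lt ENNReal.coe_ne_top, ENNReal.coe_toReal]
    linarith
  have hlim : Tendsto (fun ε : ℝ => ((p : ℝ) + ε) * (q + ε)) (𝓝[>] 0) (𝓝 ((p + 0) * (q + 0))) :=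
    (Continuous.tendsto (by fun_prop) (0 : ℝ)).mono_left nhdsWithin_le_nhds
  have hfin : c ^ n ≤ (p : ℝ) * q := by
    rw [add_zero, add_zero] at hlim
    refine ge_of_tendsto hlim ?_
    filter_upwards [self_mem_nhdsWithin] with ε hε
    exact key _ _ (hlt p ε hε) (hlt q ε hε)
  rw [← ENNReal.ofReal_pow hc.le]
  refine ENNReal.ofReal_le_of_le_toReal ?_
  simpa using hfin

theorem inverseSantaloOn_equivalences [Fintype Γ] {c : ℝ} (hc : 0 < c) :
    (InverseSantaloOn n c (IsInvFun ρ) ↔ ∀ ν₁ ∈ P1inv ρ, ∀ ν₂ ∈ P1inv ρ,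
      TransportEntropyIneq c (P1inv ρ) ν₁ ν₂) ∧
    (InverseSantaloOn n c (IsInvFun ρ) ↔ ∀ ν₁ ∈ P1inv ρ, ∀ ν₂ ∈ P1inv ρ,
      IsCompact ν₁.support → IsCompact ν₂.support → TransportEntropyIneq c (P1inv ρ) ν₁ ν₂) :=
  ⟨⟨fun h _ h₁ _ h₂ => h.transportEntropyIneq hc h₁ h₂,
    fun h => inverseSantaloOn_of_transportEntropyIneq hc fun _ h₁ _ h₂ _ _ => h _ h₁ _ h₂⟩,
   ⟨fun h _ h₁ _ h₂ _ _ => h.transportEntropyIneq hc h₁ h₂,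
    fun h => inverseSantaloOn_of_transportEntropyIneq hc h⟩⟩

end Converse

/-! ### The trivial, symmetric and unconditional group actions -/

section SignGroups

variable {n : ℕ}

theorem isInvFun_one : (IsInvFun (1 : Unit →* (Rn n ≃ₗᵢ[ℝ] Rn n))) = fun _ => True := by
  ext f
  simp [IsInvFun]

theorem P1inv_one : P1inv (1 : Unit →* (Rn n ≃ₗᵢ[ℝ] Rn n)) = P1 n := by
  ext ν
  refine ⟨fun h => h.1, fun h => ⟨h, fun γ => ?_⟩⟩
  exact Measure.map_id

/-- Coordinatewise multiplication by signs, as a linear isometry. -/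
noncomputable def signIsometry (ε : Fin n → ℤˣ) : Rn n ≃ₗᵢ[ℝ] Rn n where
  toFun := flip fun i => ((ε i : ℤ) : ℝ)
  invFun := flip fun i => ((ε i : ℤ) : ℝ)
  map_add' x y := by ext i; simp [flip, mul_add]
  map_smul' a x := by ext i; simp [flip, mul_left_comm]
  left_inv x := by
    ext i
    rcases Int.units_eq_one_or (ε i) with h | h <;> simp [flip, h]
  right_inv x := by
    ext i
    rcases Int.units_eq_one_or (ε i) with h | h <;> simp [flip, h]
  norm_map' x := by
    simp only [EuclideanSpace.norm_eq]
    congr 1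
    refine Finset.sum_congr rfl fun i _ => ?_
    rcases Int.units_eq_one_or (ε i) with h | h <;> simp [flip, h]

theorem signIsometry_apply (ε : Fin n → ℤˣ) (x : Rn n) :
    signIsometry ε x = flip (fun i => ((ε i : ℤ) : ℝ)) x := rfl

/-- The action of `{-1, 1}ⁿ` on `ℝⁿ`. -/
noncomputable def signHom (n : ℕ) : (Fin n → ℤˣ) →* (Rn n ≃ₗᵢ[ℝ] Rn n) where
  toFun := signIsometry
  map_one' := by
    ext x i
    simp [signIsometry_apply, flip]
  map_mul' ε ε' := by
    ext x i
    simp [signIsometry_apply, flip, mul_assoc]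

theorem forall_isSignVector_iff {p : (Fin n → ℝ) → Prop} :
    (∀ ε, IsSignVector ε → p ε) ↔ ∀ ε : Fin n → ℤˣ, p fun i => ((ε i : ℤ) : ℝ) := by
  constructor
  · refine fun h ε => h _ fun i => ?_
    rcases Int.units_eq_one_or (ε i) with h | h <;> simp [h]
  · intro h ε hε
    choose s hs using fun i => show ∃ s : ℤˣ, ((s : ℤ) : ℝ) = ε i from
      (hε i).elim (fun h => ⟨1, by simp [h]⟩) fun h => ⟨-1, by simp [h]⟩
    have := h s
    simpa only [hs] using this

theorem isInvFun_signHom : IsInvFun (signHom n) = IsUncondFun := by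
  ext f
  exact (forall_isSignVector_iff (p := fun ε => ∀ x, f (flip ε x) = f x)).symm

theorem P1inv_signHom : P1inv (signHom n) = P1uncond n := by
  ext ν
  exact and_congr_right fun _ =>
    (forall_isSignVector_iff (p := fun ε => ν.map (flip ε) = ν)).symm

/-- The action of `{-1, 1}` on `ℝⁿ` by multiplication. -/
noncomputable def negHom (n : ℕ) : ℤˣ →* (Rn n ≃ₗᵢ[ℝ] Rn n) :=
  (signHom n).comp (Pi.constMonoidHom (Fin n) ℤˣ)

theorem coe_negHom_one : ⇑(negHom n 1) = id := by
  rw [map_one]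
  rfl

theorem coe_negHom_neg_one : ⇑(negHom n (-1)) = fun x => -x := by
  ext x i
  show flip _ x i = _
  simp [flip]

theorem isInvFun_negHom : IsInvFun (negHom n) = IsSymmFun := by
  ext f
  refine ⟨fun h x => ?_, fun h γ x => ?_⟩
  · have := h (-1) x
    rwa [coe_negHom_neg_one] at this
  · rcases Int.units_eq_one_or γ with rfl | rfl
    · rw [coe_negHom_one, id]
    · rw [coe_negHom_neg_one]
      exact h x

theorem P1inv_negHom : P1inv (negHom n) = P1symm n := by
  ext ν
  refine and_congr_right fun _ => ⟨fun h => ?_, fun h γ => ?_⟩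
  · have := h (-1)
    rwa [coe_negHom_neg_one] at this
  · rcases Int.units_eq_one_or γ with rfl | rfl
    · rw [coe_negHom_one, Measure.map_id]
    · rwa [coe_negHom_neg_one]

end SignGroups

end InverseSantalo

theorem corollary3p3 (n : ℕ) (hn : 1 ≤ n) (c : ℝ) (hc : 0 < c) :
    -- general functions and measures
    ((InverseSantalo.IS n c ↔
        ∀ ν₁ ∈ InverseSantalo.P1 n, ∀ ν₂ ∈ InverseSantalo.P1 n,
          InverseSantalo.TransportEntropyIneq c (InverseSantalo.P1 n) ν₁ ν₂) ∧
      (InverseSantalo.IS n c ↔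
        ∀ ν₁ ∈ InverseSantalo.P1 n, ∀ ν₂ ∈ InverseSantalo.P1 n,
          IsCompact ν₁.support → IsCompact ν₂.support →
          InverseSantalo.TransportEntropyIneq c (InverseSantalo.P1 n) ν₁ ν₂)) ∧
    -- symmetric functions and measures
    ((InverseSantalo.ISsymm n c ↔
        ∀ ν₁ ∈ InverseSantalo.P1symm n, ∀ ν₂ ∈ InverseSantalo.P1symm n,
          InverseSantalo.TransportEntropyIneq c (InverseSantalo.P1symm n) ν₁ ν₂) ∧
      (InverseSantalo.ISsymm n c ↔
        ∀ ν₁ ∈ InverseSantalo.P1symm n, ∀ ν₂ ∈ InverseSantalo.P1symm n,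
          IsCompact ν₁.support → IsCompact ν₂.support →
          InverseSantalo.TransportEntropyIneq c (InverseSantalo.P1symm n) ν₁ ν₂)) ∧
    -- unconditional functions and measures
    ((InverseSantalo.ISuncond n c ↔
        ∀ ν₁ ∈ InverseSantalo.P1uncond n, ∀ ν₂ ∈ InverseSantalo.P1uncond n,
          InverseSantalo.TransportEntropyIneq c (InverseSantalo.P1uncond n) ν₁ ν₂) ∧
      (InverseSantalo.ISuncond n c ↔
        ∀ ν₁ ∈ InverseSantalo.P1uncond n, ∀ ν₂ ∈ InverseSantalo.P1uncond n,
          IsCompact ν₁.support → IsCompact ν₂.support →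
          InverseSantalo.TransportEntropyIneq c (InverseSantalo.P1uncond n) ν₁ ν₂)) := by
  refine ⟨?_, ?_, ?_⟩
  · have h := InverseSantalo.inverseSantaloOn_equivalences
      (ρ := (1 : Unit →* (InverseSantalo.Rn n ≃ₗᵢ[ℝ] InverseSantalo.Rn n))) hc
    rwa [InverseSantalo.isInvFun_one, InverseSantalo.P1inv_one] at h
  · have h := InverseSantalo.inverseSantaloOn_equivalences (ρ := InverseSantalo.negHom n) hc
    rwa [InverseSantalo.isInvFun_negHom, InverseSantalo.P1inv_negHom] at h
  · have h := InverseSantalo.inverseSantaloOn_equivalences (ρ := InverseSantalo.signHom n) hc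
    rwa [InverseSantalo.isInvFun_signHom, InverseSantalo.P1inv_signHom] at h
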